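/- Fix $\tau\in\mathbb C$ with $\operatorname{Im}\tau>0$, and for $z\in\mathbb C$ write $q=e^{2\pi i\tau}$, $x=e^{2\pi i z}$. Write $(a;q)_n=\prod_{k=0}^{n-1}(1-aq^k)$, $(a;q)=\prod_{n\ge 0}(1-q^na)$ and $\langle a;q\rangle=(a;q)(q/a;q)$, and let $\mathbb H^-=\{z\in\mathbb C:\operatorname{Im}z<0\}$. Let $\mathcal T_{\mathbb H^-}(qx^2-x)$ be the space of holomorphic functions $F$ on $\mathbb H^-$ of period $1$ such that $F(z)=(qx^2-x)\,F(z+\tau)$ whenever $z,z+\tau\in\mathbb H^-$. For each $k\in\{0,1\}$ there is a unique function $[qx^2-x;k]\in\mathcal T_{\mathbb H^-}(qx^2-x)$ whose Fourier expansion in $\mathbb H^-$ has coefficient of $x^j$ equal to $1$ if $j=k$ and to $0$ if $j\ne k$, for $j\in\{0,1\}$; here the coefficient of $x^j$ is $\int_w^{w+1}F(z)e^{-2\pi i jz}\,dz$ for any $w\in\mathbb H^-$. In $\mathcal T_{\mathbb H^-}(qx^2-x)$ one has $$(q;q)\,\langle x;q\rangle\,(qx;q)=\sum_{m\in\mathbb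 Z,\;n\ge 0}\frac{q^{\binom m2+\binom{n+1}2}}{(q;q)_n}(-x)^{m+n}=\frac{[qx^2-x;0]}{\langle q^2;q^5\rangle}-\frac{[qx^2-x;1]}{\langle q;q^5\rangle},$$ where the double series converges absolutely for every $z\in\mathbb H^-$. For each $\tau$, these two equalities (for all $z\in\mathbb H^-$) are equivalent to the two Rogers–Ramanujan identities $$\sum_{n\ge 0}\frac{q^{n^2}}{(q;q)_n}=\frac1{\langle q;q^5\rangle},\qquad \sum_{n\ge 0}\frac{q^{n^2+n}}{(q;q)_n}=\frac1{\langle q^2;q^5\rangle}.$$ More precisely, for all $a,b\in\mathbb C$, the double series equals $a\,[qx^2-x;0]-b\,[qx^2-x;1]$ for all $z\in\mathbb H^-$ if and only if $\sum_{n\ge 0}q^{n^2+n}/(q;q)_n=a$ and $\sum_{n\ge 0}q^{n^2}/(q;q)_n=b$. -/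

import Mathlib

open Set

noncomputable section

namespace RogRam

/-- `e z = exp (2 π i z)`; thus `q = e τ` and `x = e z`. -/
def e (z : ℂ) : ℂ := Complex.exp (2 * Real.pi * Complex.I * z)

/-- The lower half-plane `{z : Im z < 0}`. -/
def lowerHalfPlane : Set ℂ := {z : ℂ | z.im < 0}

/-- The finite product `(a; q)_n = ∏_{k < n} (1 - a q^k)`. -/
def qPoch (a q : ℂ) (n : ℕ) : ℂ := ∏ k ∈ Finset.range n, (1 - a * q ^ k)

/-- The infinite product `(a; q) = ∏_{n ≥ 0} (1 - q^n a)`. -/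
def qPochInf (a q : ℂ) : ℂ := ∏' n : ℕ, (1 - q ^ n * a)

/-- The infinite product defining `(a; q)` converges whenever `|q| < 1`. -/
theorem multipliable_qPochInf (a q : ℂ) (hq : ‖q‖ < 1) :
    Multipliable (fun n : ℕ => 1 - q ^ n * a) := by
  have h : Summable (fun n : ℕ => ‖-(q ^ n * a)‖) := by
    simp only [norm_neg, norm_mul, norm_pow]
    exact (summable_geometric_of_lt_one (norm_nonneg q) hq).mul_right _
  simpa [sub_eq_add_neg] using multipliable_one_add_of_summable h

/-- The modified theta function `⟨x; q⟩ = (x; q) (q / x; q)`. -/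
def qTheta (x q : ℂ) : ℂ := qPochInf x q * qPochInf (q / x) q

/-- The space `T_D(f)` of holomorphic, `1`-periodic functions `F` on `D` such that
`F z = f z * F (z + τ)` whenever `z` and `z + τ` both lie in `D`. Here `D` is a domain closed
under translation by integers. Functions on `D` are represented by functions on `ℂ` whose values
outside `D` play no role, so that equality in `T_D(f)` is equality on `D`. -/
def TSpace (τ : ℂ) (D : Set ℂ) (f : ℂ → ℂ) : Submodule ℂ (ℂ → ℂ) where
  carrier := {F | DifferentiableOn ℂ F D ∧ (∀ z ∈ D, F (z + 1) = F z) ∧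
    ∀ z ∈ D, z + τ ∈ D → F z = f z * F (z + τ)}
  zero_mem' := ⟨differentiableOn_const 0, by simp, by simp⟩
  add_mem' := by
    rintro F G ⟨hF, hF', hF''⟩ ⟨hG, hG', hG''⟩
    refine ⟨hF.add hG, fun z hz => ?_, fun z hz hz' => ?_⟩
    · simp [hF' z hz, hG' z hz]
    · simp [hF'' z hz hz', hG'' z hz hz', mul_add]
  smul_mem' := by
    rintro c F ⟨hF, hF', hF''⟩
    refine ⟨hF.const_smul c, fun z hz => ?_, fun z hz hz' => ?_⟩
    · simp [hF' z hz]
    · simp [hF'' z hz hz', mul_left_comm]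

/-- The `n`-th Fourier coefficient `∫_w^{w+1} F(z) exp(-2 π i n z) dz` of `F`, computed on the
horizontal segment starting at `w`. -/
def fourierCoeffAt (F : ℂ → ℂ) (w : ℂ) (n : ℤ) : ℂ :=
  ∫ t in (0 : ℝ)..1, F (w + t) * e (-(n * (w + t)))

/-- `F` is the canonical vector `[f; k]`, for `f` a polynomial in `x` of degree `d`: it belongs to
`T_D(f)`, where `D` is the lower half-plane, and its Fourier coefficient of `x^j` in `D` is `1`
if `j = k` and `0` otherwise, for `0 ≤ j < d`. -/
def IsCanonicalVector (τ : ℂ) (f : ℂ → ℂ) (d k : ℕ) (F : ℂ → ℂ) : Prop :=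
  F ∈ TSpace τ lowerHalfPlane f ∧
    ∀ j < d, ∀ w ∈ lowerHalfPlane, fourierCoeffAt F w j = if j = k then 1 else 0

/-- The function `q x^2 - x` of `z`. -/
def quadFactor (τ z : ℂ) : ℂ := e τ * e z ^ 2 - e z

/-- The product `(q; q) ⟨x; q⟩ (q x; q)` as a function of `z`. -/
def productSide (τ z : ℂ) : ℂ :=
  qPochInf (e τ) (e τ) * qTheta (e z) (e τ) * qPochInf (e τ * e z) (e τ)

/-- The summand `q^(C(m,2) + C(n+1,2)) / (q; q)_n * (-x)^(m+n)`, for `m ∈ ℤ` and `n ≥ 0`. The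
integer divisions by `2` are exact. -/
def doubleTerm (τ z : ℂ) (p : ℤ × ℕ) : ℂ :=
  e τ ^ (p.1 * (p.1 - 1) / 2 + (p.2 + 1) * p.2 / 2 : ℤ) / qPoch (e τ) (e τ) p.2 *
    (-e z) ^ (p.1 + p.2 : ℤ)

/-- The two Rogers-Ramanujan identities at `q = e τ`. -/
def RogersRamanujan (τ : ℂ) : Prop :=
  HasSum (fun n : ℕ => e τ ^ (n ^ 2) / qPoch (e τ) (e τ) n) (1 / qTheta (e τ) (e τ ^ 5)) ∧
  HasSum (fun n : ℕ => e τ ^ (n ^ 2 + n) / qPoch (e τ) (e τ) n) (1 / qTheta (e τ ^ 2) (e τ ^ 5))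

end RogRam

end

/-! Comparing coefficients of x^j in F(z) = (q x^2 - x) F(z + τ) gives a_j = q^(j-1) (a_(j-2) -
a_(j-1)). This recurrence can be solved in both directions, so F is determined by a_0 and a_1
(`eqOn_zero_of_mem_TSpace`), and every pair of values occurs because the resulting series converges
for |x| > 1 (`exists_isRecurrent`). The space therefore has dimension two, with the canonical
vectors as a basis.

The product satisfies the functional equation (`productSide_functional`). Expanding its theta factor
by the Jacobi triple product and (qx; q) by Euler's series gives the double series
(`hasSum_doubleTerm`), whose coefficients of x^0 and x^1 are ∑ q^(n^2+n)/(q;q)_n and -∑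
q^(n^2)/(q;q)_n. An equality with a combination of canonical vectors is thus a statement about these
two sums, which is the equivalence.

The Rogers-Ramanujan identities are proved separately, by a Bailey-type argument. A finite identity
writes 1/(q;q)_n as an alternating sum over r with pentagonal exponents (`hasSum_pentTerm`,
`hasSum_pentTerm_succ`). After weighting by q^(n^2+nε) and exchanging the sums, the sum over n is
evaluated by the Durfee rectangle identity, and the remaining theta series in r by the triple
product in base q^5 (`hasSum_rogersRamanujan`). The triple product itself follows from Euler's
series and the Durfee identity. -/

open Filter Topology

namespace RogRam

/-! ### Triangular exponents and convergence of theta series -/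

/-- The binomial coefficient `m (m - 1) / 2` of an integer `m`. -/
def tri (m : ℤ) : ℤ := m * (m - 1) / 2

theorem two_mul_tri (m : ℤ) : 2 * tri m = m * (m - 1) :=
  Int.mul_ediv_cancel' (Int.even_mul_pred_self m).two_dvd

theorem tri_zero : tri 0 = 0 := rfl

theorem tri_add_one (m : ℤ) : tri (m + 1) = tri m + m := by
  linarith [two_mul_tri m, two_mul_tri (m + 1)]

theorem tri_neg (m : ℤ) : tri (-m) = tri m + m := by
  linarith [two_mul_tri m, two_mul_tri (-m)]

theorem tri_add (m n : ℤ) : tri (m + n) = tri m + tri n + m * n := by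
  linarith [two_mul_tri m, two_mul_tri n, two_mul_tri (m + n)]

theorem summable_norm_pow_tri_nat {q : ℂ} (hq : ‖q‖ < 1) (hq0 : q ≠ 0) {y : ℂ} (hy : y ≠ 0) :
    Summable fun n : ℕ => ‖q ^ tri n * y ^ n‖ := by
  refine summable_of_ratio_test_tendsto_lt_one zero_lt_one
    (Eventually.of_forall fun n => norm_ne_zero_iff.2
      (mul_ne_zero (zpow_ne_zero _ hq0) (pow_ne_zero _ hy))) ?_
  have h : ∀ n : ℕ, ‖‖q ^ tri (n + 1 : ℕ) * y ^ (n + 1)‖‖ / ‖‖q ^ tri n * y ^ n‖‖ =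
      ‖q‖ ^ n * ‖y‖ := by
    intro n
    have h1 : ‖q‖ ≠ 0 := norm_ne_zero_iff.2 hq0
    have h2 : ‖y‖ ≠ 0 := norm_ne_zero_iff.2 hy
    rw [norm_norm, norm_norm, Nat.cast_succ, tri_add_one, zpow_add₀ hq0]
    simp only [norm_mul, norm_pow, norm_zpow, zpow_natCast]
    field_simp
    ring
  simp only [h]
  simpa using (tendsto_pow_atTop_nhds_zero_of_lt_one (norm_nonneg q) hq).mul_const ‖y‖

theorem summable_norm_zpow_tri {q : ℂ} (hq : ‖q‖ < 1) (hq0 : q ≠ 0) {y : ℂ} (hy : y ≠ 0) :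
    Summable fun m : ℤ => ‖q ^ tri m * y ^ m‖ := by
  refine Summable.of_nat_of_neg ?_ ?_
  · simpa using summable_norm_pow_tri_nat hq hq0 hy
  · refine (summable_norm_pow_tri_nat hq hq0 (div_ne_zero hq0 hy)).congr fun n => ?_
    -- The terms of negative index form the same one-sided series, with y replaced by q/y.
    rw [tri_neg, zpow_add₀ hq0, zpow_neg, div_pow]
    simp [div_eq_mul_inv, mul_assoc]

theorem summable_norm_zpow_sq {q : ℂ} (hq : ‖q‖ < 1) (hq0 : q ≠ 0) (k : ℤ) :
    Summable fun m : ℤ => ‖q ^ (m ^ 2 + m * k)‖ := by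
  have hq2 : ‖q ^ 2‖ < 1 := by
    rw [norm_pow]; exact pow_lt_one₀ (norm_nonneg q) hq two_ne_zero
  -- Since m^2 + m k = 2 tri m + (1 + k) m, this is a theta series in base q^2.
  refine (summable_norm_zpow_tri hq2 (pow_ne_zero 2 hq0) (zpow_ne_zero (1 + k) hq0)).congr
    fun m => ?_
  rw [← zpow_natCast q 2, ← zpow_mul, ← zpow_mul, ← zpow_add₀ hq0]
  congr 2
  push_cast
  rw [two_mul_tri]
  ring

/-! ### Reciprocals of q-factorials -/

/-- The reciprocal `1 / (q; q)_n`, extended by zero to negative `n`. -/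
noncomputable def qRecip (q : ℂ) (n : ℤ) : ℂ := if 0 ≤ n then 1 / qPoch q q n.toNat else 0

theorem qRecip_natCast (q : ℂ) (n : ℕ) : qRecip q n = 1 / qPoch q q n := by
  simp [qRecip]

theorem qRecip_zero (q : ℂ) : qRecip q 0 = 1 := by
  simp [qRecip, qPoch]

theorem qRecip_of_neg (q : ℂ) {n : ℤ} (hn : n < 0) : qRecip q n = 0 := by
  simp [qRecip, not_le.2 hn]

theorem one_sub_pow_ne_zero {q : ℂ} (hq : ‖q‖ < 1) {n : ℕ} (hn : n ≠ 0) : 1 - q ^ n ≠ 0 := by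
  intro h
  have h1 : ‖q ^ n‖ < 1 := by rw [norm_pow]; exact pow_lt_one₀ (norm_nonneg q) hq hn
  rw [← sub_eq_zero.1 h] at h1
  simp at h1

theorem qPoch_self_ne_zero {q : ℂ} (hq : ‖q‖ < 1) (n : ℕ) : qPoch q q n ≠ 0 := by
  refine Finset.prod_ne_zero_iff.2 fun k _ => ?_
  rw [← pow_succ']
  exact one_sub_pow_ne_zero hq k.succ_ne_zero

/-- The extension by zero makes this hold at n = 0 as well, where both sides vanish. Sums over all
of ℤ can then be shifted without boundary terms, and every recursion below rests on this. -/
theorem one_sub_mul_qRecip {q : ℂ} (hq : ‖q‖ < 1) (n : ℤ) :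
    (1 - q ^ n) * qRecip q n = qRecip q (n - 1) := by
  rcases lt_trichotomy n 0 with hn | rfl | hn
  · rw [qRecip_of_neg q hn, qRecip_of_neg q (by omega), mul_zero]
  · rw [qRecip_of_neg q (by omega : (0 : ℤ) - 1 < 0)]; simp
  · obtain ⟨k, rfl⟩ : ∃ k : ℕ, n = k + 1 := ⟨(n - 1).toNat, by omega⟩
    have h := one_sub_pow_ne_zero hq k.succ_ne_zero
    have h' := qPoch_self_ne_zero hq k
    rw [add_sub_cancel_right, qRecip_natCast, ← Nat.cast_succ, qRecip_natCast, zpow_natCast, qPoch,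
      Finset.prod_range_succ, ← qPoch, ← pow_succ']
    field_simp

theorem tendsto_qPoch {q : ℂ} (hq : ‖q‖ < 1) (a : ℂ) :
    Tendsto (fun n => qPoch a q n) atTop (𝓝 (qPochInf a q)) := by
  simpa only [qPoch, qPochInf, mul_comm a] using (multipliable_qPochInf a q hq).hasProd.tendsto_prod_nat

theorem qPochInf_ne_zero {q : ℂ} (hq : ‖q‖ < 1) {a : ℂ} (ha : ∀ n : ℕ, 1 - q ^ n * a ≠ 0) :
    qPochInf a q ≠ 0 := by
  have h := tprod_one_add_ne_zero_of_summable (f := fun n : ℕ => -(q ^ n * a))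
    (fun n => by rw [← sub_eq_add_neg]; exact ha n) (by
      simp only [norm_neg, norm_mul, norm_pow]
      exact (summable_geometric_of_lt_one (norm_nonneg q) hq).mul_right _)
  simpa only [qPochInf, ← sub_eq_add_neg] using h

theorem qPochInf_self_ne_zero {q : ℂ} (hq : ‖q‖ < 1) : qPochInf q q ≠ 0 :=
  qPochInf_ne_zero hq fun n => by
    rw [← pow_succ]; exact one_sub_pow_ne_zero hq n.succ_ne_zero

theorem tendsto_qRecip {q : ℂ} (hq : ‖q‖ < 1) :
    Tendsto (fun n : ℕ => qRecip q n) atTop (𝓝 (1 / qPochInf q q)) := by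
  simpa only [qRecip_natCast, one_div] using (tendsto_qPoch hq q).inv₀ (qPochInf_self_ne_zero hq)

theorem exists_norm_qRecip_le {q : ℂ} (hq : ‖q‖ < 1) : ∃ C > 0, ∀ n : ℤ, ‖qRecip q n‖ ≤ C := by
  obtain ⟨C, hC, h⟩ := (Metric.isBounded_range_of_tendsto _ (tendsto_qRecip hq)).exists_pos_norm_le
  refine ⟨C, hC, fun n => ?_⟩
  rcases lt_or_ge n 0 with hn | hn
  · rw [qRecip_of_neg q hn, norm_zero]; exact hC.le
  · lift n to ℕ using hn
    exact h _ ⟨n, rfl⟩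

/-! ### Euler's expansion -/

theorem summable_norm_euler {q : ℂ} (hq : ‖q‖ < 1) (hq0 : q ≠ 0) {y : ℂ} (hy : y ≠ 0) :
    Summable fun n : ℤ => ‖q ^ tri n * qRecip q n * y ^ n‖ := by
  obtain ⟨C, hC, h⟩ := exists_norm_qRecip_le hq
  refine Summable.of_nonneg_of_le (fun n => norm_nonneg _) (fun n => ?_)
    ((summable_norm_zpow_tri hq hq0 hy).mul_left C)
  rw [mul_right_comm, norm_mul _ (qRecip q n), mul_comm C]
  gcongr
  exact h n

/-- In the difference of the series at y and at qy, each term acquires a factor 1 - q^n, which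
lowers the index of the reciprocal; shifting n by one then exhibits y times the series at qy. -/
theorem tsum_euler_step {q : ℂ} (hq : ‖q‖ < 1) (hq0 : q ≠ 0) {y : ℂ} (hy : y ≠ 0) :
    ∑' n : ℤ, q ^ tri n * qRecip q n * y ^ n =
      (1 + y) * ∑' n : ℤ, q ^ tri n * qRecip q n * (q * y) ^ n := by
  have h1 := (summable_norm_euler hq hq0 hy).of_norm
  have h2 := (summable_norm_euler hq hq0 (mul_ne_zero hq0 hy)).of_norm
  rw [add_mul, one_mul, ← sub_eq_iff_eq_add', ← h1.tsum_sub h2, ← tsum_mul_left,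
    ← (Equiv.addRight (1 : ℤ)).tsum_eq]
  refine tsum_congr fun n => ?_
  have h := one_sub_mul_qRecip hq (n + 1)
  rw [add_sub_cancel_right] at h
  rw [Equiv.coe_addRight, mul_zpow, mul_zpow, ← h, tri_add_one, zpow_add₀ hq0, zpow_add_one₀ hy,
    zpow_add_one₀ hq0]
  ring

/-- Only n = 0 survives: terms of positive index contain (q^n)^N, which tends to 0, and those of
negative index are zero. -/
theorem tendsto_tsum_euler {q : ℂ} (hq : ‖q‖ < 1) (hq0 : q ≠ 0) {y : ℂ} (hy : y ≠ 0) :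
    Tendsto (fun N : ℕ => ∑' n : ℤ, q ^ tri n * qRecip q n * (q ^ N * y) ^ n) atTop (𝓝 1) := by
  have hlim : ∑' n : ℤ, (if n = 0 then (1 : ℂ) else 0) = 1 := tsum_ite_eq 0 _
  rw [← hlim]
  have hz : ∀ (N : ℕ) (n : ℤ), q ^ tri n * qRecip q n * (q ^ N * y) ^ n =
      q ^ tri n * qRecip q n * y ^ n * (q ^ n) ^ N := by
    intro N n
    rw [mul_zpow, ← zpow_natCast, ← zpow_natCast, zpow_comm]
    ring
  simp only [hz]
  refine tendsto_tsum_of_dominated_convergence (summable_norm_euler hq hq0 hy) (fun n => ?_)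
    (Eventually.of_forall fun N n => ?_)
  · rcases lt_trichotomy n 0 with hn | rfl | hn
    · simp [qRecip_of_neg q hn, hn.ne]
    · simp [tri_zero, qRecip_zero]
    · lift n to ℕ using hn.le
      have : ‖q ^ (n : ℤ)‖ < 1 := by
        rw [zpow_natCast, norm_pow]
        exact pow_lt_one₀ (norm_nonneg q) hq (by omega)
      have hn0 : n ≠ 0 := by omega
      simpa [hn0] using (tendsto_pow_atTop_nhds_zero_of_norm_lt_one this).const_mul
        (q ^ tri n * qRecip q n * y ^ n)
  · rcases lt_or_ge n 0 with hn | hn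
    · simp [qRecip_of_neg q hn]
    · lift n to ℕ using hn
      rw [norm_mul _ ((q ^ (n : ℤ)) ^ N)]
      refine mul_le_of_le_one_right (norm_nonneg _) ?_
      rw [zpow_natCast, norm_pow, norm_pow]
      exact pow_le_one₀ (by positivity) (pow_le_one₀ (norm_nonneg q) hq.le)

/-- Euler's expansion of `(x; q)`. -/
theorem hasSum_euler {q : ℂ} (hq : ‖q‖ < 1) (hq0 : q ≠ 0) {x : ℂ} (hx : x ≠ 0) :
    HasSum (fun n : ℤ => q ^ tri n * qRecip q n * (-x) ^ n) (qPochInf x q) := by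
  have hx' : -x ≠ 0 := neg_ne_zero.2 hx
  have key : ∀ N : ℕ, ∑' n : ℤ, q ^ tri n * qRecip q n * (-x) ^ n =
      qPoch x q N * ∑' n : ℤ, q ^ tri n * qRecip q n * (q ^ N * -x) ^ n := by
    intro N
    induction N with
    | zero => simp [qPoch]
    | succ N ih =>
      rw [ih, tsum_euler_step hq hq0 (mul_ne_zero (pow_ne_zero N hq0) hx'), qPoch, qPoch,
        Finset.prod_range_succ, pow_succ' q N, mul_assoc q]
      ring
  have h := ((tendsto_qPoch hq x).mul (tendsto_tsum_euler hq hq0 hx')).congr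
    fun N => (key N).symm
  rw [mul_one, tendsto_const_nhds_iff] at h
  rw [← h]
  exact (summable_norm_euler hq hq0 hx').of_norm.hasSum

/-! ### The Durfee rectangle identity -/

theorem summable_norm_durfee {q : ℂ} (hq : ‖q‖ < 1) (hq0 : q ≠ 0) (k : ℤ) (f g : ℤ → ℤ) :
    Summable fun m : ℤ => ‖q ^ (m ^ 2 + m * k) * qRecip q (f m) * qRecip q (g m)‖ := by
  obtain ⟨C, hC, h⟩ := exists_norm_qRecip_le hq
  refine Summable.of_nonneg_of_le (fun n => norm_nonneg _) (fun m => ?_)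
    ((summable_norm_zpow_sq hq hq0 k).mul_right (C * C))
  rw [norm_mul, norm_mul, mul_assoc]
  gcongr <;> exact h _

/-- Both sums equal S + q^(k+1) T, where S has weight q^(m^2+m(k+1)) and reciprocals at m and m + k,
and T has weight q^(m^2+m(k+2)) and reciprocals at m and m + k + 1. One side uses the recursion on
the first reciprocal and a shift of m, the other the recursion on the second. -/
theorem tsum_durfee_add_one {q : ℂ} (hq : ‖q‖ < 1) (hq0 : q ≠ 0) (k : ℤ) :
    ∑' m : ℤ, q ^ (m ^ 2 + m * (k + 1)) * qRecip q m * qRecip q (m + (k + 1)) =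
      ∑' m : ℤ, q ^ (m ^ 2 + m * k) * qRecip q m * qRecip q (m + k) := by
  have h1 := (summable_norm_durfee hq hq0 k (fun m => m) (fun m => m + k)).of_norm
  have h2 := (summable_norm_durfee hq hq0 (k + 1) (fun m => m) (fun m => m + (k + 1))).of_norm
  have h3 := (summable_norm_durfee hq hq0 (k + 1) (fun m => m) (fun m => m + k)).of_norm
  have h4 := ((summable_norm_durfee hq hq0 (k + 1 + 1) (fun m => m)
    (fun m => m + (k + 1))).of_norm).mul_left (q ^ (k + 1))
  have e1 := h1.tsum_sub h3
  have e2 := h2.tsum_sub h4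
  have e3 : ∑' m : ℤ, (q ^ (m ^ 2 + m * k) * qRecip q m * qRecip q (m + k) -
      q ^ (m ^ 2 + m * (k + 1)) * qRecip q m * qRecip q (m + k)) =
      ∑' m : ℤ, q ^ (k + 1) * (q ^ (m ^ 2 + m * (k + 1 + 1)) * qRecip q m *
        qRecip q (m + (k + 1))) := by
    rw [← (Equiv.addRight (1 : ℤ)).tsum_eq]
    refine tsum_congr fun m => ?_
    have h := one_sub_mul_qRecip hq (m + 1)
    rw [add_sub_cancel_right] at h
    have a1 : (m + 1) ^ 2 + (m + 1) * k = (k + 1) + (m ^ 2 + m * (k + 1 + 1)) := by ring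
    have a2 : (m + 1) ^ 2 + (m + 1) * (k + 1) =
      (k + 1) + (m ^ 2 + m * (k + 1 + 1)) + (m + 1) := by ring
    rw [Equiv.coe_addRight, a2, a1, ← h, zpow_add₀ hq0 _ (m + 1), zpow_add₀ hq0 (k + 1),
      show m + 1 + k = m + (k + 1) by ring]
    ring
  have e4 : ∑' m : ℤ, (q ^ (m ^ 2 + m * (k + 1)) * qRecip q m * qRecip q (m + (k + 1)) -
      q ^ (k + 1) * (q ^ (m ^ 2 + m * (k + 1 + 1)) * qRecip q m * qRecip q (m + (k + 1)))) =
      ∑' m : ℤ, q ^ (m ^ 2 + m * (k + 1)) * qRecip q m * qRecip q (m + k) := by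
    refine tsum_congr fun m => ?_
    have h := one_sub_mul_qRecip hq (m + (k + 1))
    rw [show m + (k + 1) - 1 = m + k by ring] at h
    rw [← h, show m ^ 2 + m * (k + 1 + 1) = m ^ 2 + m * (k + 1) + m by ring,
      zpow_add₀ hq0 _ m, zpow_add₀ hq0 m (k + 1)]
    ring
  linear_combination e4 - e2 + e1 - e3

theorem tendsto_tsum_durfee {q : ℂ} (hq : ‖q‖ < 1) (hq0 : q ≠ 0) :
    Tendsto (fun N : ℕ => ∑' m : ℤ, q ^ (m ^ 2 + m * N) * qRecip q m * qRecip q (m + N)) atTop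
      (𝓝 (1 / qPochInf q q)) := by
  have hlim : ∑' n : ℤ, (if n = 0 then (1 / qPochInf q q : ℂ) else 0) = 1 / qPochInf q q :=
    tsum_ite_eq 0 _
  rw [← hlim]
  obtain ⟨C, hC, h⟩ := exists_norm_qRecip_le hq
  have hpow : ∀ (m N : ℕ), q ^ ((m : ℤ) ^ 2 + m * N) = q ^ m ^ 2 * (q ^ m) ^ N := by
    intro m N
    rw [← pow_mul, ← pow_add, ← zpow_natCast]
    push_cast
    rfl
  refine tendsto_tsum_of_dominated_convergence
    ((summable_norm_zpow_sq hq hq0 0).mul_right (C * C)) (fun m => ?_)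
    (Eventually.of_forall fun N m => ?_)
  · rcases lt_trichotomy m 0 with hn | rfl | hn
    · simp [qRecip_of_neg q hn, hn.ne]
    · simpa [qRecip_zero] using tendsto_qRecip hq
    · lift m to ℕ using hn.le
      have hm : ‖q ^ m‖ < 1 := by
        rw [norm_pow]
        exact pow_lt_one₀ (norm_nonneg q) hq (by omega)
      have h2 : Tendsto (fun N : ℕ => qRecip q (m + N)) atTop (𝓝 (1 / qPochInf q q)) := by
        have := (tendsto_add_atTop_iff_nat m).2 (tendsto_qRecip hq)
        refine this.congr fun N => ?_
        rw [Nat.cast_add, add_comm]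
      have h3 := ((((tendsto_pow_atTop_nhds_zero_of_norm_lt_one hm).const_mul (q ^ m ^ 2)).mul_const
        (qRecip q m)).mul h2)
      have hn0 : m ≠ 0 := by omega
      simpa [hn0, hpow] using h3
  · rcases lt_or_ge m 0 with hn | hn
    · rw [qRecip_of_neg q hn]
      simp only [mul_zero, zero_mul, norm_zero]
      positivity
    · lift m to ℕ using hn
      rw [norm_mul, norm_mul, mul_assoc, hpow, norm_mul]
      have hle : ‖q ^ m ^ 2‖ * ‖(q ^ m) ^ N‖ ≤ ‖q ^ ((m : ℤ) ^ 2 + m * 0)‖ := by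
        have : q ^ ((m : ℤ) ^ 2 + m * 0) = q ^ m ^ 2 := by
          rw [mul_zero, add_zero, ← zpow_natCast]; push_cast; rfl
        rw [this]
        refine mul_le_of_le_one_right (norm_nonneg _) ?_
        rw [norm_pow, norm_pow]
        exact pow_le_one₀ (by positivity) (pow_le_one₀ (norm_nonneg q) hq.le)
      gcongr <;> exact h _

/-- The Durfee rectangle identity. -/
theorem hasSum_durfee {q : ℂ} (hq : ‖q‖ < 1) (hq0 : q ≠ 0) (k : ℤ) :
    HasSum (fun m : ℤ => q ^ (m ^ 2 + m * k) * qRecip q m * qRecip q (m + k))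
      (1 / qPochInf q q) := by
  set D : ℤ → ℂ := fun k => ∑' m : ℤ, q ^ (m ^ 2 + m * k) * qRecip q m * qRecip q (m + k) with hD
  have hstep : ∀ k, D (k + 1) = D k := tsum_durfee_add_one hq hq0
  have hconst : ∀ N : ℕ, D (k + N) = D k := by
    intro N
    induction N with
    | zero => simp
    | succ N ih => rw [Nat.cast_succ, ← add_assoc, hstep, ih]
  have hlim : Tendsto (fun N : ℕ => D N) atTop (𝓝 (1 / qPochInf q q)) := tendsto_tsum_durfee hq hq0
  -- The sum does not depend on k, including negative k, so it equals its limit as k tends to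
  -- infinity.
  have hev : ∀ᶠ N : ℕ in atTop, D N = D k := by
    filter_upwards [eventually_ge_atTop k.toNat] with N hN
    rw [← hconst (N - k).toNat]
    congr 1
    omega
  have h : D k = 1 / qPochInf q q :=
    tendsto_nhds_unique ((tendsto_congr' hev).2 tendsto_const_nhds) hlim
  rw [← h]
  exact (summable_norm_durfee hq hq0 k (fun m => m) (fun m => m + k)).of_norm.hasSum

/-! ### The Jacobi triple product -/

theorem hasSum_of_hasSum_diagonal {F : ℤ × ℤ → ℂ} {g : ℤ → ℂ} {s : ℂ} (hF : HasSum F s)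
    (hg : ∀ k, HasSum (fun b : ℤ => F (b + k, b)) (g k)) : HasSum g s := by
  let φ : ℤ × ℤ ≃ ℤ × ℤ :=
    { toFun := fun p => (p.2 + p.1, p.2)
      invFun := fun p => (p.1 - p.2, p.2)
      left_inv := fun p => by ext <;> simp
      right_inv := fun p => by ext <;> simp }
  exact (φ.hasSum_iff.2 hF).prod_fiberwise hg

theorem euler_mul_euler {q : ℂ} (hq0 : q ≠ 0) {x : ℂ} (hx : x ≠ 0) (k b : ℤ) :
    q ^ tri (b + k) * qRecip q (b + k) * (-x) ^ (b + k) *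
      (q ^ tri b * qRecip q b * (-(q / x)) ^ b) =
      q ^ tri k * (-x) ^ k * (q ^ (b ^ 2 + b * k) * qRecip q b * qRecip q (b + k)) := by
  have hx' : -x ≠ 0 := neg_ne_zero.2 hx
  have hexp : tri (b + k) + tri b + b = tri k + (b ^ 2 + b * k) := by
    rw [tri_add]; linarith [two_mul_tri b]
  have h3 : q ^ tri (b + k) * q ^ tri b * q ^ b = q ^ tri k * q ^ (b ^ 2 + b * k) := by
    rw [← zpow_add₀ hq0, ← zpow_add₀ hq0, ← zpow_add₀ hq0, hexp]
  have h4 : (-(q / x)) ^ b = q ^ b * ((-x) ^ b)⁻¹ := by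
    rw [← inv_zpow, ← mul_zpow, inv_neg, mul_neg, div_eq_mul_inv]
  have h5 : (-x) ^ b * ((-x) ^ b)⁻¹ = 1 := mul_inv_cancel₀ (zpow_ne_zero _ hx')
  rw [h4, zpow_add₀ hx']
  generalize ((-x) ^ b)⁻¹ = u at *
  linear_combination (qRecip q (b + k) * qRecip q b * (-x) ^ k) * h3 +
    (qRecip q (b + k) * qRecip q b * (-x) ^ k * q ^ tri (b + k) * q ^ tri b * q ^ b) * h5
-- Multiply the Euler series at x and at q/x and collect the power k of -x: the inner sum is the
-- Durfee sum with parameter k.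
theorem hasSum_jacobi_div {q : ℂ} (hq : ‖q‖ < 1) (hq0 : q ≠ 0) {x : ℂ} (hx : x ≠ 0) :
    HasSum (fun k : ℤ => q ^ tri k * (-x) ^ k * (1 / qPochInf q q)) (qTheta x q) := by
  have hy : q / x ≠ 0 := div_ne_zero hq0 hx
  have hs := summable_mul_of_summable_norm (summable_norm_euler hq hq0 (neg_ne_zero.2 hx))
      (summable_norm_euler hq hq0 (neg_ne_zero.2 hy))
  have hprod := HasSum.mul (hasSum_euler hq hq0 hx) (hasSum_euler hq hq0 hy) hs
  refine hasSum_of_hasSum_diagonal hprod fun k => ?_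
  have h := (hasSum_durfee hq hq0 k).mul_left (q ^ tri k * (-x) ^ k)
  rw [← funext (euler_mul_euler hq0 hx k)] at h
  exact h

/-- The Jacobi triple product identity. -/
theorem hasSum_jacobi {q : ℂ} (hq : ‖q‖ < 1) (hq0 : q ≠ 0) {x : ℂ} (hx : x ≠ 0) :
    HasSum (fun k : ℤ => q ^ tri k * (-x) ^ k) (qPochInf q q * qTheta x q) := by
  have h0 := qPochInf_self_ne_zero hq
  have h2 : HasSum (fun k : ℤ => q ^ tri k * (-x) ^ k * (1 / qPochInf q q)) (qTheta x q) :=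
    hasSum_jacobi_div hq hq0 hx
  have h3 := h2.mul_left (qPochInf q q)
  have hf : (fun k : ℤ => q ^ tri k * (-x) ^ k) =
      fun k => qPochInf q q * (q ^ tri k * (-x) ^ k * (1 / qPochInf q q)) := by
    funext k
    rw [mul_one_div, mul_div_cancel₀ _ h0]
  rw [hf]
  exact h3

/-! ### Finite identities with pentagonal exponents -/

/-- The summand of the finite Rogers-Ramanujan type sums. -/
noncomputable def pentTerm (q : ℂ) (c n n' r : ℤ) : ℂ :=
  (-1) ^ r * q ^ (3 * tri r + c * r) * qRecip q (n - r) * qRecip q (n' + r)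

theorem pentTerm_eq_zero (q : ℂ) (c n n' r : ℤ) (h : n < r ∨ r < -n') :
    pentTerm q c n n' r = 0 := by
  rcases h with h | h
  · simp [pentTerm, qRecip_of_neg q (show n - r < 0 by omega)]
  · simp [pentTerm, qRecip_of_neg q (show n' + r < 0 by omega)]

theorem summable_pentTerm (q : ℂ) (c n n' : ℤ) : Summable (pentTerm q c n n') := by
  refine summable_of_ne_finset_zero (s := Finset.Icc (-n') n) fun r hr => ?_
  refine pentTerm_eq_zero q c n n' r ?_
  rw [Finset.mem_Icc] at hr
  omega

theorem neg_one_zpow_neg (r : ℤ) : (-1 : ℂ) ^ (-r) = (-1) ^ r := by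
  rw [zpow_neg, ← inv_zpow, inv_neg, inv_one]

theorem tsum_pentTerm_reflect (q : ℂ) (c n n' : ℤ) :
    ∑' r, pentTerm q c n n' r = ∑' r, pentTerm q (3 - c) n' n r := by
  rw [← (Equiv.neg ℤ).tsum_eq]
  refine tsum_congr fun r => ?_
  rw [Equiv.neg_apply, pentTerm, pentTerm, neg_one_zpow_neg, tri_neg,
    show 3 * (tri r + r) + c * -r = 3 * tri r + (3 - c) * r by ring, sub_neg_eq_add,
    ← sub_eq_add_neg]
  ring

/-- Reflecting r and then shifting it by one permutes the terms and reverses every sign, so the sum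
is its own negative. -/
theorem tsum_pentTerm_three (q : ℂ) (n : ℤ) : ∑' r, pentTerm q 3 n (n + 1) r = 0 := by
  have h : ∑' r, pentTerm q 3 n (n + 1) r = -∑' r, pentTerm q 3 n (n + 1) r := by
    conv_lhs => rw [tsum_pentTerm_reflect, ← (Equiv.addRight (1 : ℤ)).tsum_eq]
    rw [← tsum_neg]
    refine tsum_congr fun r => ?_
    rw [Equiv.coe_addRight, pentTerm, pentTerm, tri_add_one, zpow_add_one₀ (by norm_num),
      show 3 * (tri r + r) + (3 - 3) * (r + 1) = 3 * tri r + 3 * r by ring,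
      show n + 1 - (r + 1) = n - r by ring, show n + (r + 1) = n + 1 + r by ring]
    ring
  exact self_eq_neg.1 h

/-- Raising the index of the second reciprocal produces a correction with c = 3, which vanishes by
antisymmetry. -/
theorem tsum_pentTerm_eq_succ {q : ℂ} (hq : ‖q‖ < 1) (hq0 : q ≠ 0) (n : ℤ) :
    ∑' r, pentTerm q 2 n n r = ∑' r, pentTerm q 2 n (n + 1) r := by
  have h : ∀ r, pentTerm q 2 n n r =
      pentTerm q 2 n (n + 1) r - q ^ (n + 1) * pentTerm q 3 n (n + 1) r := by
    intro r
    have h1 := one_sub_mul_qRecip hq (n + 1 + r)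
    rw [show n + 1 + r - 1 = n + r by ring, zpow_add₀ hq0] at h1
    rw [pentTerm, pentTerm, pentTerm, ← h1,
      show 3 * tri r + 3 * r = 3 * tri r + 2 * r + r by ring, zpow_add₀ hq0 _ r]
    ring
  rw [tsum_congr h, (summable_pentTerm _ _ _ _).tsum_sub ((summable_pentTerm _ _ _ _).mul_left _),
    tsum_mul_left, tsum_pentTerm_three, mul_zero, sub_zero]

/-- Raising the index of the first reciprocal produces a correction with c = 1; reflection turns it
into the c = 2 sum, because the two indices are then equal. -/
theorem tsum_pentTerm_step {q : ℂ} (hq : ‖q‖ < 1) (hq0 : q ≠ 0) (n : ℤ) :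
    ∑' r, pentTerm q 2 n (n + 1) r =
      (1 - q ^ (n + 1)) * ∑' r, pentTerm q 2 (n + 1) (n + 1) r := by
  have h : ∀ r, pentTerm q 2 n (n + 1) r =
      pentTerm q 2 (n + 1) (n + 1) r - q ^ (n + 1) * pentTerm q 1 (n + 1) (n + 1) r := by
    intro r
    have h1 := one_sub_mul_qRecip hq (n + 1 - r)
    have h2 : q ^ (n + 1) = q ^ (n + 1 - r) * q ^ r := by rw [← zpow_add₀ hq0]; congr 1; ring
    rw [show n + 1 - r - 1 = n - r by ring] at h1
    rw [pentTerm, pentTerm, pentTerm, ← h1, h2,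
      show 3 * tri r + 2 * r = 3 * tri r + 1 * r + r by ring, zpow_add₀ hq0 _ r]
    ring
  rw [tsum_congr h, (summable_pentTerm _ _ _ _).tsum_sub ((summable_pentTerm _ _ _ _).mul_left _),
    tsum_mul_left, tsum_pentTerm_reflect q 1, show (3 : ℤ) - 1 = 2 by norm_num]
  ring

theorem hasSum_pentTerm {q : ℂ} (hq : ‖q‖ < 1) (hq0 : q ≠ 0) (n : ℤ) :
    HasSum (pentTerm q 2 n n) (qRecip q n) := by
  suffices h : ∑' r, pentTerm q 2 n n r = qRecip q n by
    rw [← h]; exact (summable_pentTerm _ _ _ _).hasSum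
  rcases lt_or_ge n 0 with hn | hn
  · rw [qRecip_of_neg q hn, ← tsum_zero (α := ℂ) (β := ℤ)]
    exact tsum_congr fun r => pentTerm_eq_zero q 2 n n r (by omega)
  · lift n to ℕ using hn
    induction n with
    | zero =>
      rw [tsum_eq_single 0 fun r hr => pentTerm_eq_zero q 2 _ _ r (by omega)]
      simp [pentTerm, tri_zero, qRecip_zero]
    | succ n ih =>
      have h1 := one_sub_mul_qRecip hq (n + 1)
      rw [add_sub_cancel_right] at h1
      rw [tsum_pentTerm_eq_succ hq hq0, tsum_pentTerm_step hq hq0, ← h1] at ih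
      have h2 : 1 - q ^ ((n : ℤ) + 1) ≠ 0 := by
        exact_mod_cast one_sub_pow_ne_zero hq n.succ_ne_zero
      exact_mod_cast mul_left_cancel₀ h2 ih

theorem hasSum_pentTerm_succ {q : ℂ} (hq : ‖q‖ < 1) (hq0 : q ≠ 0) (n : ℤ) :
    HasSum (pentTerm q 2 n (n + 1)) (qRecip q n) := by
  rw [← (hasSum_pentTerm hq hq0 n).tsum_eq, tsum_pentTerm_eq_succ hq hq0]
  exact (summable_pentTerm _ _ _ _).hasSum

/-! ### The Rogers-Ramanujan identities -/

theorem norm_pow_lt_one {q : ℂ} (hq : ‖q‖ < 1) {n : ℕ} (hn : n ≠ 0) : ‖q ^ n‖ < 1 := by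
  rw [norm_pow]; exact pow_lt_one₀ (norm_nonneg q) hq hn

theorem summable_sq_mul_pentTerm {q : ℂ} (hq : ‖q‖ < 1) (hq0 : q ≠ 0) (ε : ℤ) :
    Summable fun p : ℤ × ℤ => q ^ (p.1 ^ 2 + p.1 * ε) * pentTerm q 2 p.1 (p.1 + ε) p.2 := by
  obtain ⟨C, hC, h⟩ := exists_norm_qRecip_le hq
  have h3 : ‖q ^ 3‖ < 1 := norm_pow_lt_one hq three_ne_zero
  have hs := ((summable_norm_zpow_sq hq hq0 ε).mul_of_nonneg (summable_norm_zpow_tri h3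
    (pow_ne_zero 3 hq0) (pow_ne_zero 2 hq0)) (fun _ => norm_nonneg _)
    fun _ => norm_nonneg _).mul_right (C * C)
  refine Summable.of_norm_bounded hs fun p => ?_
  have he : q ^ (3 * tri p.2 + 2 * p.2) = (q ^ 3) ^ tri p.2 * (q ^ 2) ^ p.2 := by
    rw [← zpow_natCast, ← zpow_natCast, ← zpow_mul, ← zpow_mul, ← zpow_add₀ hq0]
    rfl
  rw [pentTerm, he, norm_mul, norm_mul, norm_mul, norm_mul, norm_zpow (-1 : ℂ), norm_neg, norm_one,
    one_zpow, one_mul, mul_assoc _ ‖qRecip q _‖, ← mul_assoc]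
  gcongr <;> exact h _

theorem hasSum_sq_mul_pentTerm {q : ℂ} (hq : ‖q‖ < 1) (hq0 : q ≠ 0) (ε r : ℤ) :
    HasSum (fun n : ℤ => q ^ (n ^ 2 + n * ε) * pentTerm q 2 n (n + ε) r)
      ((q ^ 5) ^ tri r * (-q ^ (3 + ε)) ^ r * (1 / qPochInf q q)) := by
  -- Substituting n = m + r gives reciprocals at m and m + 2r + ε. The exponent left over is r^2 +
  -- rε + 3 tri r + 2r = 5 tri r + (3 + ε) r, hence the base q^5.
  have h := (hasSum_durfee hq hq0 (2 * r + ε)).mul_left ((q ^ 5) ^ tri r * (-q ^ (3 + ε)) ^ r)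
  rw [← (Equiv.addRight r).hasSum_iff]
  refine h.congr_fun fun m => ?_
  have he : (q ^ 5) ^ tri r * (-q ^ (3 + ε)) ^ r * q ^ (m ^ 2 + m * (2 * r + ε)) =
      (-1) ^ r * (q ^ ((m + r) ^ 2 + (m + r) * ε) * q ^ (3 * tri r + 2 * r)) := by
    rw [← zpow_natCast, neg_eq_neg_one_mul (q ^ (3 + ε)), mul_zpow, ← zpow_mul, ← zpow_mul,
      ← zpow_add₀ hq0, mul_left_comm, ← zpow_add₀ hq0, mul_assoc, ← zpow_add₀ hq0]
    congr 2
    push_cast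
    linarith [two_mul_tri r]
  rw [Function.comp_apply, Equiv.coe_addRight, pentTerm, add_sub_cancel_right,
    show m + r + ε + r = m + (2 * r + ε) by ring]
  linear_combination (-(qRecip q m * qRecip q (m + (2 * r + ε)))) * he

/-- The double sum over n and r is evaluated in both orders: over r first by the finite identity
`hε`, over n first by Durfee and then by the triple product at q^(3+ε). The two Rogers-Ramanujan
identities are ε = 0 and ε = 1. -/
theorem hasSum_rogersRamanujan {q : ℂ} (hq : ‖q‖ < 1) (hq0 : q ≠ 0) (ε : ℕ)
    (hε : ∀ n : ℤ, HasSum (pentTerm q 2 n (n + ε)) (qRecip q n)) :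
    HasSum (fun n : ℕ => q ^ (n ^ 2 + n * ε) / qPoch q q n)
      (qPochInf (q ^ 5) (q ^ 5) * qTheta (q ^ (3 + ε)) (q ^ 5) * (1 / qPochInf q q)) := by
  have hs := (summable_sq_mul_pentTerm hq hq0 ε).hasSum
  have h1 := hs.prod_fiberwise fun n => (hε n).mul_left (q ^ (n ^ 2 + n * (ε : ℤ)))
  have h2 := ((Equiv.prodComm ℤ ℤ).hasSum_iff.2 hs).prod_fiberwise
    (hasSum_sq_mul_pentTerm hq hq0 ε)
  have h3 := (hasSum_jacobi (norm_pow_lt_one hq (n := 5) (by norm_num)) (pow_ne_zero 5 hq0)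
    (pow_ne_zero (3 + ε) hq0)).mul_right (1 / qPochInf q q)
  have h4 : ∀ r : ℤ, (q ^ 5) ^ tri r * (-q ^ (3 + (ε : ℤ))) ^ r * (1 / qPochInf q q) =
      (q ^ 5) ^ tri r * (-q ^ (3 + ε)) ^ r * (1 / qPochInf q q) := by
    intro r
    rw [← zpow_natCast q (3 + ε)]
    push_cast
    rfl
  rw [← h3.unique (h2.congr_fun fun r => (h4 r).symm)] at h1
  rw [← Nat.cast_injective (R := ℤ).hasSum_iff] at h1
  · refine h1.congr_fun fun n => ?_
    rw [Function.comp_apply, qRecip_natCast, mul_one_div, ← zpow_natCast]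
    push_cast
    rfl
  · intro n hn
    rw [qRecip_of_neg q (not_le.1 fun h => hn ⟨n.toNat, by omega⟩), mul_zero]

/-- The factors 1 - q^k are grouped by k modulo 5 in the first 5N factors, and then N tends to
infinity. -/
theorem qPochInf_self_eq_mul {q : ℂ} (hq : ‖q‖ < 1) :
    qPochInf q q = qPochInf q (q ^ 5) * qPochInf (q ^ 2) (q ^ 5) * qPochInf (q ^ 3) (q ^ 5) *
      qPochInf (q ^ 4) (q ^ 5) * qPochInf (q ^ 5) (q ^ 5) := by
  have h5 := norm_pow_lt_one hq (n := 5) (by norm_num)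
  have h : ∀ N, qPoch q (q ^ 5) N * qPoch (q ^ 2) (q ^ 5) N * qPoch (q ^ 3) (q ^ 5) N *
      qPoch (q ^ 4) (q ^ 5) N * qPoch (q ^ 5) (q ^ 5) N = qPoch q q (5 * N) := by
    intro N
    induction N with
    | zero => simp [qPoch]
    | succ N ih =>
      have e : qPoch q q (5 * (N + 1)) = qPoch q q (5 * N) * (1 - q * q ^ (5 * N)) *
          (1 - q * q ^ (5 * N + 1)) * (1 - q * q ^ (5 * N + 2)) * (1 - q * q ^ (5 * N + 3)) *
          (1 - q * q ^ (5 * N + 4)) := by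
        simp only [qPoch, Nat.mul_succ, Finset.prod_range_succ]
      have e' : ∀ a : ℂ, qPoch a (q ^ 5) (N + 1) = qPoch a (q ^ 5) N * (1 - a * (q ^ 5) ^ N) :=
        fun a => Finset.prod_range_succ _ _
      rw [e, ← ih]
      simp only [e', pow_add, pow_mul]
      ring
  have hl := ((((tendsto_qPoch h5 q).mul (tendsto_qPoch h5 (q ^ 2))).mul
    (tendsto_qPoch h5 (q ^ 3))).mul (tendsto_qPoch h5 (q ^ 4))).mul (tendsto_qPoch h5 (q ^ 5))
  have hr := (tendsto_qPoch hq q).comp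
    (tendsto_id.const_mul_atTop' (show 0 < 5 by norm_num) : Tendsto (fun N : ℕ => 5 * N) atTop atTop)
  exact tendsto_nhds_unique hr (hl.congr h)

/-- The first Rogers-Ramanujan identity. -/
theorem hasSum_rogersRamanujan_one {q : ℂ} (hq : ‖q‖ < 1) (hq0 : q ≠ 0) :
    HasSum (fun n : ℕ => q ^ n ^ 2 / qPoch q q n) (1 / qTheta q (q ^ 5)) := by
  have h := hasSum_rogersRamanujan hq hq0 0 (by simpa using hasSum_pentTerm hq hq0)
  have hne := qPochInf_self_ne_zero hq
  rw [qPochInf_self_eq_mul hq] at h hne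
  simp only [mul_ne_zero_iff] at hne
  obtain ⟨⟨⟨⟨h1, h2⟩, h3⟩, h4⟩, h5⟩ := hne
  have e1 : q ^ 5 / q ^ (3 + 0) = q ^ 2 := by field_simp
  have e2 : q ^ 5 / q = q ^ 4 := by field_simp
  rw [qTheta, e1] at h
  rw [qTheta, e2]
  convert h using 1
  · simp
  · field_simp

/-- The second Rogers-Ramanujan identity. -/
theorem hasSum_rogersRamanujan_two {q : ℂ} (hq : ‖q‖ < 1) (hq0 : q ≠ 0) :
    HasSum (fun n : ℕ => q ^ (n ^ 2 + n) / qPoch q q n) (1 / qTheta (q ^ 2) (q ^ 5)) := by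
  have h := hasSum_rogersRamanujan hq hq0 1 (by simpa using hasSum_pentTerm_succ hq hq0)
  have hne := qPochInf_self_ne_zero hq
  rw [qPochInf_self_eq_mul hq] at h hne
  simp only [mul_ne_zero_iff] at hne
  obtain ⟨⟨⟨⟨h1, h2⟩, h3⟩, h4⟩, h5⟩ := hne
  have e1 : q ^ 5 / q ^ (3 + 1) = q := by field_simp
  have e2 : q ^ 5 / q ^ 2 = q ^ 3 := by field_simp
  rw [qTheta, e1] at h
  rw [qTheta, e2]
  convert h using 1
  · simp
  · field_simp

/-! ### The exponential e(z) -/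

theorem e_add (z w : ℂ) : e (z + w) = e z * e w := by
  rw [e, e, e, mul_add, Complex.exp_add]

theorem e_ne_zero (z : ℂ) : e z ≠ 0 := Complex.exp_ne_zero _

theorem e_zero : e 0 = 1 := by simp [e]

theorem e_int_mul (n : ℤ) (z : ℂ) : e (n * z) = e z ^ n := by
  rw [e, e, ← Complex.exp_int_mul]
  congr 1
  ring

theorem e_neg (z : ℂ) : e (-z) = (e z)⁻¹ := by
  rw [e, e, mul_neg, Complex.exp_neg]

theorem e_neg_int_mul (n : ℤ) (z : ℂ) : e (-(n * z)) = (e z ^ n)⁻¹ := by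
  rw [e_neg, e_int_mul]

theorem e_one : e 1 = 1 := by
  simp [e]

theorem e_add_one (z : ℂ) : e (z + 1) = e z := by
  rw [e_add, e_one, mul_one]

theorem norm_e (z : ℂ) : ‖e z‖ = Real.exp (-(2 * Real.pi * z.im)) := by
  rw [e, Complex.norm_exp]
  congr 1
  simp

theorem one_lt_norm_e {z : ℂ} (hz : z ∈ lowerHalfPlane) : 1 < ‖e z‖ := by
  rw [norm_e, Real.one_lt_exp_iff]
  have : z.im < 0 := hz
  nlinarith [Real.pi_pos]

theorem norm_e_lt_one {τ : ℂ} (hτ : 0 < τ.im) : ‖e τ‖ < 1 := by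
  rw [norm_e, Real.exp_lt_one_iff]
  nlinarith [Real.pi_pos]

theorem differentiable_e : Differentiable ℂ e := by
  unfold e
  fun_prop

theorem continuous_e : Continuous e := differentiable_e.continuous

theorem add_ofReal_mem {w : ℂ} (hw : w ∈ lowerHalfPlane) (t : ℝ) :
    w + t ∈ lowerHalfPlane := by
  have : w.im < 0 := hw
  simpa [lowerHalfPlane] using this

theorem integral_e (n : ℤ) (w : ℂ) :
    ∫ t in (0 : ℝ)..1, e (n * (w + t)) = if n = 0 then 1 else 0 := by
  split_ifs with hn
  · simp [hn, e_zero]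
  · have hc : 2 * Real.pi * Complex.I * n ≠ 0 :=
      mul_ne_zero Complex.two_pi_I_ne_zero (Int.cast_ne_zero.2 hn)
    have h : ∀ t : ℝ, e (n * (w + t)) =
        e (n * w) * Complex.exp (2 * Real.pi * Complex.I * n * t) := by
      intro t
      rw [mul_add, e_add, e, e]
      congr 2
      ring
    have h1 : Complex.exp (2 * Real.pi * Complex.I * n) = 1 :=
      Complex.exp_eq_one_iff.2 ⟨n, by ring⟩
    simp only [h]
    rw [intervalIntegral.integral_const_mul, integral_exp_mul_complex hc]
    simp [h1]

/-! ### Laurent series in x on the lower half-plane -/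

/-- The function of `z` with Fourier expansion `∑ a_j x^j`. -/
noncomputable def laurentSum (a : ℤ → ℂ) (z : ℂ) : ℂ := ∑' j : ℤ, a j * e z ^ j

/-- Absolute convergence of `∑ a_j x^j` for `|x| > 1`. -/
def IsLaurentCoeff (a : ℤ → ℂ) : Prop := ∀ R : ℝ, 1 < R → Summable fun j : ℤ => ‖a j‖ * R ^ j

theorem IsLaurentCoeff.summable_norm {a : ℤ → ℂ} (ha : IsLaurentCoeff a) {z : ℂ}
    (hz : z ∈ lowerHalfPlane) : Summable fun j : ℤ => ‖a j * e z ^ j‖ := by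
  simpa only [norm_mul, norm_zpow] using ha _ (one_lt_norm_e hz)

theorem IsLaurentCoeff.hasSum {a : ℤ → ℂ} (ha : IsLaurentCoeff a) {z : ℂ}
    (hz : z ∈ lowerHalfPlane) : HasSum (fun j : ℤ => a j * e z ^ j) (laurentSum a z) :=
  (ha.summable_norm hz).of_norm.hasSum

theorem zpow_le_zpow_add_zpow {r s t : ℝ} (hr : 0 < r) (hrs : r ≤ s) (hst : s ≤ t) (j : ℤ) :
    s ^ j ≤ r ^ j + t ^ j := by
  have hs := hr.trans_le hrs
  have ht := hs.trans_le hst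
  rcases le_or_gt 0 j with hj | hj
  · have := zpow_le_zpow_left₀ hj hs.le hst
    have := zpow_pos hr j
    linarith
  · have h1 : (s ^ (-j))⁻¹ ≤ (r ^ (-j))⁻¹ :=
      inv_anti₀ (zpow_pos hr _) (zpow_le_zpow_left₀ (by omega) hr.le hrs)
    rw [zpow_neg, zpow_neg, inv_inv, inv_inv] at h1
    have := zpow_pos ht j
    linarith

theorem IsLaurentCoeff.differentiableOn {a : ℤ → ℂ} (ha : IsLaurentCoeff a) :
    DifferentiableOn ℂ (laurentSum a) lowerHalfPlane := by
  intro z hz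
  -- On the annulus r < |x| < R the terms are dominated by their values at the two radii, which
  -- gives a uniform summable bound.
  obtain ⟨r, hr1, hr⟩ := exists_between (one_lt_norm_e hz)
  obtain ⟨R, hR⟩ := exists_gt ‖e z‖
  have hopen : IsOpen {w : ℂ | r < ‖e w‖ ∧ ‖e w‖ < R} :=
    (isOpen_lt continuous_const continuous_e.norm).inter
      (isOpen_lt continuous_e.norm continuous_const)
  have h := Complex.differentiableOn_tsum_of_summable_norm
    (F := fun (j : ℤ) (w : ℂ) => a j * e w ^ j)
    ((ha r hr1).add (ha R ((hr1.trans hr).trans hR)))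
    (fun j => ((differentiable_e.differentiableOn).zpow (Or.inl fun w _ => e_ne_zero w)).const_mul
      (a j)) hopen fun j w hw => by
      rw [norm_mul, norm_zpow, ← mul_add]
      gcongr
      exact zpow_le_zpow_add_zpow (zero_lt_one.trans hr1) hw.1.le hw.2.le j
  exact (h.differentiableAt (hopen.mem_nhds ⟨hr, hR⟩)).differentiableWithinAt

theorem IsLaurentCoeff.fourierCoeffAt {a : ℤ → ℂ} (ha : IsLaurentCoeff a) {w : ℂ}
    (hw : w ∈ lowerHalfPlane) (n : ℤ) : fourierCoeffAt (laurentSum a) w n = a n := by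
  have hterm : ∀ (j : ℤ) (t : ℝ), a j * e (w + t) ^ j * e (-(n * (w + t))) =
      a j * e ((j - n : ℤ) * (w + t)) := by
    intro j t
    rw [e_neg_int_mul, e_int_mul, zpow_sub₀ (e_ne_zero _), mul_assoc, div_eq_mul_inv]
  have hnorm : ∀ (j : ℤ) (t : ℝ), ‖a j * e (w + t) ^ j * e (-(n * (w + t)))‖ =
      ‖a j * e w ^ j‖ * ‖e w ^ n‖⁻¹ := by
    intro j t
    have : ‖e (w + t)‖ = ‖e w‖ := by rw [norm_e, norm_e]; simp
    rw [e_neg_int_mul, norm_mul, norm_mul, norm_inv, norm_zpow, norm_zpow, this, norm_mul,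
      norm_zpow, norm_zpow]
  have hs := (ha.summable_norm hw).mul_right ‖e w ^ n‖⁻¹
  have h := intervalIntegral.hasSum_integral_of_dominated_convergence (a := 0) (b := 1)
    (μ := MeasureTheory.volume)
    (F := fun (j : ℤ) (t : ℝ) => a j * e (w + t) ^ j * e (-(n * (w + t))))
    (f := fun t : ℝ => laurentSum a (w + t) * e (-(n * (w + t))))
    (fun j _ => ‖a j * e w ^ j‖ * ‖e w ^ n‖⁻¹)
    (fun j => by
      refine Continuous.aestronglyMeasurable ?_
      simp only [hterm]
      exact continuous_const.mul (continuous_e.comp (by fun_prop)))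
    (fun j => Eventually.of_forall fun t _ => (hnorm j t).le)
    (Eventually.of_forall fun t _ => hs) (by simp)
    (Eventually.of_forall fun t _ => (ha.hasSum (add_ofReal_mem hw t)).mul_right _)
  simp only [hterm, intervalIntegral.integral_const_mul, integral_e] at h
  refine h.unique ?_
  refine (hasSum_ite_eq n (a n)).congr_fun fun j => ?_
  by_cases hj : j = n
  · simp [hj]
  · simp [hj, sub_ne_zero.2 hj]

/-! ### The recurrence and existence of canonical vectors -/

/-- The recurrence for the Fourier coefficients of elements of `T(q x^2 - x)`. -/
def IsRecurrent (τ : ℂ) (a : ℤ → ℂ) : Prop :=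
  ∀ j : ℤ, a j = e τ ^ (j - 1) * (a (j - 2) - a (j - 1))

theorem IsLaurentCoeff.mem_TSpace {τ : ℂ} {a : ℤ → ℂ} (ha : IsLaurentCoeff a)
    (hrec : IsRecurrent τ a) : laurentSum a ∈ TSpace τ lowerHalfPlane (quadFactor τ) := by
  refine ⟨ha.differentiableOn, fun z _ => by simp only [laurentSum, e_add_one],
    fun z hz hz' => ?_⟩
  have h := ha.hasSum hz'
  have h1 := ((Equiv.subRight (1 : ℤ)).hasSum_iff.2 h).mul_left (e z)
  have h2 := ((Equiv.subRight (2 : ℤ)).hasSum_iff.2 h).mul_left (e τ * e z ^ 2)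
  refine (ha.hasSum hz).unique ?_
  rw [quadFactor, sub_mul]
  refine (h2.sub h1).congr_fun fun j => ?_
  have hq := e_ne_zero τ
  have hz := e_ne_zero z
  simp only [Function.comp_apply, Equiv.subRight_apply]
  rw [hrec j, e_add, mul_zpow, mul_zpow, mul_comm (e z ^ _), mul_comm (e z ^ _)]
  have h3 : e τ ^ (j - 1) = e τ * e τ ^ (j - 2) := by
    rw [← zpow_one_add₀ hq]; congr 1; ring
  have h4 : e z ^ j = e z ^ 2 * e z ^ (j - 2) := by
    rw [← zpow_natCast, ← zpow_add₀ hz]; congr 1; push_cast; ring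
  have h5 : e z ^ j = e z * e z ^ (j - 1) := by
    rw [← zpow_one_add₀ hz]; congr 1; ring
  rw [mul_sub, sub_mul]
  congr 1
  · rw [h3, h4]; ring
  · rw [h5]; ring

theorem exists_two_step_recursion (f : ℕ → ℂ → ℂ → ℂ) (α β : ℂ) :
    ∃ u : ℕ → ℂ, u 0 = α ∧ u 1 = β ∧ ∀ n, u (n + 2) = f n (u n) (u (n + 1)) := by
  let U : ℕ → ℂ × ℂ := fun n => Nat.rec (α, β) (fun n p => (p.2, f n p.1 p.2)) n
  exact ⟨fun n => (U n).1, rfl, rfl, fun n => rfl⟩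

theorem summable_of_two_step_le {w ε : ℕ → ℝ} (hw : ∀ n, 0 ≤ w n)
    (hε : Tendsto ε atTop (𝓝 0)) (h : ∀ n, w (n + 2) ≤ ε n * (w n + w (n + 1))) :
    Summable w := by
  -- With the bound 1/6, decay at rate 1/2 propagates: (1/6)(1 + 1/2) = (1/2)^2.
  obtain ⟨N, hN⟩ := eventually_atTop.1 (hε.eventually_le_const (show (0 : ℝ) < 1 / 6 by norm_num))
  set K := max (w N) (2 * w (N + 1))
  have hK : ∀ k, w (k + N) ≤ K * (1 / 2) ^ k ∧ w (k + 1 + N) ≤ K * (1 / 2) ^ (k + 1) := by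
    intro k
    induction k with
    | zero =>
      refine ⟨by simp [K], ?_⟩
      have : 2 * w (N + 1) ≤ K := le_max_right _ _
      rw [zero_add, add_comm 1 N]
      linarith
    | succ k ih =>
      refine ⟨ih.2, ?_⟩
      have h1 := h (k + N)
      rw [show k + N + 2 = k + 1 + 1 + N by ring, show k + N + 1 = k + 1 + N by ring] at h1
      have h2 : ε (k + N) * (w (k + N) + w (k + 1 + N)) ≤
          1 / 6 * (w (k + N) + w (k + 1 + N)) :=
        mul_le_mul_of_nonneg_right (hN _ (by omega)) (add_nonneg (hw _) (hw _))
      have h3 := ih.1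
      have h4 := ih.2
      rw [pow_succ] at h4 ⊢
      rw [pow_succ]
      linarith
  rw [← summable_nat_add_iff N]
  exact Summable.of_nonneg_of_le (fun k => hw _) (fun k => (hK k).1)
    ((summable_geometric_of_lt_one (by norm_num) (by norm_num)).mul_left K)

/-- Each step enlarges the bound by at most 1 + |q|^n, and the product of these factors converges.
Applied to coefficients of negative index, boundedness is enough, since |x| > 1. -/
theorem exists_norm_le_of_two_step {q : ℂ} (hq : ‖q‖ < 1) {v : ℕ → ℂ}
    (h : ∀ n, v (n + 2) = v (n + 1) + q ^ n * v n) : ∃ C, ∀ n, ‖v n‖ ≤ C := by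
  set K := max ‖v 0‖ ‖v 1‖
  have hK0 : 0 ≤ K := le_max_of_le_left (norm_nonneg _)
  have hp : ∀ n, ‖v n‖ ≤ K * ∏ k ∈ Finset.range n, (1 + ‖q‖ ^ k) ∧
      ‖v (n + 1)‖ ≤ K * ∏ k ∈ Finset.range n, (1 + ‖q‖ ^ k) := by
    intro n
    induction n with
    | zero => simp [K]
    | succ n ih =>
      set p := K * ∏ k ∈ Finset.range n, (1 + ‖q‖ ^ k)
      have hp0 : 0 ≤ p := (norm_nonneg _).trans ih.1
      have hpow : 0 ≤ ‖q‖ ^ n := by positivity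
      rw [Finset.prod_range_succ, ← mul_assoc, mul_add, mul_one]
      refine ⟨ih.2.trans (le_add_of_nonneg_right (mul_nonneg hp0 hpow)), ?_⟩
      rw [h n]
      refine (norm_add_le _ _).trans (add_le_add ih.2 ?_)
      rw [norm_mul, norm_pow, mul_comm]
      exact mul_le_mul_of_nonneg_right ih.1 hpow
  refine ⟨K * Real.exp (∑' k, ‖q‖ ^ k), fun n => (hp n).1.trans ?_⟩
  refine mul_le_mul_of_nonneg_left ?_ hK0
  refine (Real.prod_one_add_le_exp_sum _ fun k => by positivity).trans (Real.exp_le_exp.2 ?_)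
  exact (summable_geometric_of_lt_one (norm_nonneg q) hq).sum_le_tsum _ fun k _ => by positivity

theorem summable_forward {q : ℂ} (hq : ‖q‖ < 1) {u : ℕ → ℂ}
    (h : ∀ n, u (n + 2) = q ^ (n + 1) * (u n - u (n + 1))) {R : ℝ} (hR : 1 < R) :
    Summable fun n : ℕ => ‖u n‖ * R ^ n := by
  have hR0 : 0 < R := zero_lt_one.trans hR
  have hε : Tendsto (fun n : ℕ => ‖q‖ ^ (n + 1) * R ^ 2) atTop (𝓝 0) := by
    simpa using ((tendsto_add_atTop_iff_nat 1).2
      (tendsto_pow_atTop_nhds_zero_of_lt_one (norm_nonneg q) hq)).mul_const (R ^ 2)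
  refine summable_of_two_step_le (fun n => by positivity) hε fun n => ?_
  have h1 : ‖u (n + 2)‖ ≤ ‖q‖ ^ (n + 1) * (‖u n‖ + ‖u (n + 1)‖) := by
    rw [h, norm_mul, norm_pow]
    gcongr
    exact norm_sub_le _ _
  have h2 : ‖u (n + 1)‖ * R ^ n ≤ ‖u (n + 1)‖ * R ^ (n + 1) := by
    gcongr
    · exact hR.le
    · omega
  calc ‖u (n + 2)‖ * R ^ (n + 2)
      ≤ ‖q‖ ^ (n + 1) * (‖u n‖ + ‖u (n + 1)‖) * R ^ (n + 2) := by gcongr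
    _ = ‖q‖ ^ (n + 1) * R ^ 2 * (‖u n‖ * R ^ n + ‖u (n + 1)‖ * R ^ n) := by ring
    _ ≤ _ := by gcongr

theorem exists_isRecurrent {τ : ℂ} (hτ : 0 < τ.im) (α β : ℂ) :
    ∃ a : ℤ → ℂ, IsRecurrent τ a ∧ IsLaurentCoeff a ∧ a 0 = α ∧ a 1 = β := by
  have hq := norm_e_lt_one hτ
  have hq0 := e_ne_zero τ
  obtain ⟨u, hu0, hu1, hu⟩ := exists_two_step_recursion
    (fun n x y => e τ ^ (n + 1) * (x - y)) α β
  -- Here v n is the coefficient of x^(1-n). The two sequences overlap in degrees 0 and 1, hence the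
  -- reversed initial values.
  obtain ⟨v, hv0, hv1, hv⟩ := exists_two_step_recursion (fun n x y => y + e τ ^ n * x) β α
  let a : ℤ → ℂ := fun j => if 0 ≤ j then u j.toNat else v (1 - j).toNat
  have hau : ∀ n : ℕ, a n = u n := fun n => by simp [a]
  have hav : ∀ n : ℕ, a (1 - n) = v n := by
    intro n
    match n with
    | 0 => simp [a, hu1, hv0]
    | 1 => simp [a, hu0, hv1]
    | n + 2 =>
      have h1 : ¬ (0 : ℤ) ≤ 1 - (n + 2 : ℕ) := by push_cast; omega
      have h2 : (1 - (1 - ((n + 2 : ℕ) : ℤ))).toNat = n + 2 := by omega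
      simp only [a, if_neg h1, h2]
  refine ⟨a, fun j => ?_, fun R hR => ?_, by simpa [hu0] using hau 0, by simpa [hu1] using hau 1⟩
  · rcases le_or_gt 2 j with hj | hj
    · obtain ⟨n, rfl⟩ : ∃ n : ℕ, j = (n + 2 : ℕ) := ⟨(j - 2).toNat, by omega⟩
      rw [hau, hu, show ((n + 2 : ℕ) : ℤ) - 2 = n by push_cast; ring,
        show ((n + 2 : ℕ) : ℤ) - 1 = (n + 1 : ℕ) by push_cast; ring, hau, hau, zpow_natCast]
    · obtain ⟨n, rfl⟩ : ∃ n : ℕ, j = 1 - n := ⟨(1 - j).toNat, by omega⟩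
      rw [hav, show (1 - n : ℤ) - 2 = 1 - (n + 2 : ℕ) by push_cast; ring,
        show (1 - n : ℤ) - 1 = -n by ring, show (-n : ℤ) = 1 - (n + 1 : ℕ) by push_cast; ring,
        hav, hav, hv, add_sub_cancel_left, ← mul_assoc,
        show (1 - (n + 1 : ℕ) : ℤ) = -n by push_cast; ring, ← zpow_natCast, ← zpow_add₀ hq0]
      simp
  · refine Summable.of_nat_of_neg ?_ ?_
    · simpa [hau] using summable_forward hq hu hR
    · obtain ⟨C, hC⟩ := exists_norm_le_of_two_step hq hv
      refine Summable.of_nonneg_of_le (fun n => by positivity) (fun n => ?_)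
        ((summable_geometric_of_lt_one (inv_nonneg.2 (zero_le_one.trans hR.le))
          (inv_lt_one_of_one_lt₀ hR)).mul_left C)
      rw [show (-n : ℤ) = 1 - (n + 1 : ℕ) by push_cast; ring, hav,
        show (1 - (n + 1 : ℕ) : ℤ) = -n by push_cast; ring, zpow_neg, zpow_natCast, inv_pow]
      gcongr
      exact hC _

/-! ### Fourier coefficients and uniqueness -/

/-- The integral over a horizontal unit segment of a periodic holomorphic function on the lower
half-plane does not depend on the segment. -/
theorem integral_segment_eq {G : ℂ → ℂ} (hG : DifferentiableOn ℂ G lowerHalfPlane)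
    (hper : ∀ z ∈ lowerHalfPlane, G (z + 1) = G z) {w w' : ℂ} (hw : w ∈ lowerHalfPlane)
    (hw' : w' ∈ lowerHalfPlane) :
    ∫ t in (0 : ℝ)..1, G (w + t) = ∫ t in (0 : ℝ)..1, G (w' + t) := by
  have hline : ∀ w ∈ lowerHalfPlane,
      ∫ t in (0 : ℝ)..1, G (w + t) = ∫ t in (0 : ℝ)..1, G (t + w.im * Complex.I) := by
    intro w hw
    have hp : Function.Periodic (fun t : ℝ => G (t + w.im * Complex.I)) 1 := by
      intro t
      have hm : (t + w.im * Complex.I : ℂ) ∈ lowerHalfPlane := by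
        have : w.im < 0 := hw
        simpa [lowerHalfPlane] using this
      have h := hper _ hm
      simp only [Complex.ofReal_add, Complex.ofReal_one]
      rw [← h, add_right_comm]
    have h1 := hp.intervalIntegral_add_eq w.re 0
    rw [zero_add] at h1
    rw [← h1]
    have h2 := intervalIntegral.integral_comp_add_left (a := 0) (b := 1)
      (fun t : ℝ => G (t + w.im * Complex.I)) w.re
    rw [add_zero] at h2
    rw [← h2]
    refine intervalIntegral.integral_congr fun t _ => ?_
    have : w + t = (w.re + t : ℝ) + w.im * Complex.I := by
      conv_lhs => rw [← Complex.re_add_im w]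
      push_cast
      ring
    simp only [this]
  rw [hline w hw, hline w' hw']
  have him : w.im < 0 := hw
  have him' : w'.im < 0 := hw'
  -- Cauchy's theorem on a rectangle of width one; by periodicity the vertical sides cancel.
  have h := Complex.integral_boundary_rect_eq_zero_of_differentiableOn G (w.im * Complex.I)
    (1 + w'.im * Complex.I) (hG.mono fun z hz => by
      have := hz.2
      simp only [mem_preimage, Complex.mul_im, Complex.add_im, Complex.ofReal_re, Complex.I_im,
        Complex.ofReal_im, Complex.I_re, Complex.one_im, mul_one, mul_zero, add_zero, zero_add]
        at this
      exact (this.2.trans_lt (max_lt him him')))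
  have hv : ∫ y in w.im..w'.im, G ((1 : ℝ) + y * Complex.I) =
      ∫ y in w.im..w'.im, G ((0 : ℝ) + y * Complex.I) := by
    refine intervalIntegral.integral_congr fun y hy => ?_
    have hm : ((0 : ℝ) + y * Complex.I : ℂ) ∈ lowerHalfPlane := by
      have : y < 0 := hy.2.trans_lt (max_lt him him')
      simpa [lowerHalfPlane] using this
    rw [← hper _ hm]
    congr 1
    push_cast
    ring
  simp only [Complex.mul_re, Complex.mul_im, Complex.add_re, Complex.add_im, Complex.ofReal_re,
    Complex.I_im, Complex.ofReal_im, Complex.I_re, Complex.one_re, Complex.one_im, mul_one,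
    mul_zero, add_zero, zero_add, sub_self] at h
  rw [hv, add_sub_cancel_right, sub_eq_zero] at h
  exact h

theorem continuous_comp_segment {F : ℂ → ℂ} (hF : DifferentiableOn ℂ F lowerHalfPlane) {w : ℂ}
    (hw : w ∈ lowerHalfPlane) : Continuous fun t : ℝ => F (w + t) :=
  hF.continuousOn.comp_continuous (by fun_prop) (add_ofReal_mem hw)

theorem continuous_fourier_integrand {F : ℂ → ℂ} (hF : DifferentiableOn ℂ F lowerHalfPlane) {w : ℂ}
    (hw : w ∈ lowerHalfPlane) (n : ℤ) :
    Continuous fun t : ℝ => F (w + t) * e (-(n * (w + t))) :=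
  (continuous_comp_segment hF hw).mul (continuous_e.comp (by fun_prop))

theorem fourierCoeffAt_eq {F : ℂ → ℂ} (hF : DifferentiableOn ℂ F lowerHalfPlane)
    (hper : ∀ z ∈ lowerHalfPlane, F (z + 1) = F z) {w w' : ℂ} (hw : w ∈ lowerHalfPlane)
    (hw' : w' ∈ lowerHalfPlane) (n : ℤ) : fourierCoeffAt F w n = fourierCoeffAt F w' n := by
  refine integral_segment_eq (G := fun z => F z * e (-(n * z))) ?_ (fun z hz => ?_) hw hw'
  · exact hF.mul (differentiable_e.comp (by fun_prop)).differentiableOn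
  · simp only [hper z hz, e_neg_int_mul, e_add_one]

theorem fourierCoeffAt_sub_mul {F G : ℂ → ℂ} (hF : DifferentiableOn ℂ F lowerHalfPlane)
    (hG : DifferentiableOn ℂ G lowerHalfPlane) {w : ℂ} (hw : w ∈ lowerHalfPlane) (a b : ℂ) (n : ℤ) :
    fourierCoeffAt (fun z => a * F z - b * G z) w n =
      a * fourierCoeffAt F w n - b * fourierCoeffAt G w n := by
  simp only [fourierCoeffAt]
  rw [← intervalIntegral.integral_const_mul, ← intervalIntegral.integral_const_mul,
    ← intervalIntegral.integral_sub
      ((continuous_fourier_integrand hF hw n).const_mul a |>.intervalIntegrable _ _)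
      ((continuous_fourier_integrand hG hw n).const_mul b |>.intervalIntegrable _ _)]
  congr 1
  funext t
  ring

theorem fourierCoeffAt_congr {F G : ℂ → ℂ} (h : EqOn F G lowerHalfPlane) {w : ℂ}
    (hw : w ∈ lowerHalfPlane) (n : ℤ) : fourierCoeffAt F w n = fourierCoeffAt G w n := by
  simp only [fourierCoeffAt]
  congr 1
  funext t
  rw [h (add_ofReal_mem hw t)]

/-- The coefficients on the right are taken on the segment shifted by τ; independence of the segment
later turns this into a recurrence for a single sequence. -/
theorem fourierCoeffAt_recurrence {τ : ℂ} {F : ℂ → ℂ}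
    (hF : F ∈ TSpace τ lowerHalfPlane (quadFactor τ)) {w : ℂ} (hw : w ∈ lowerHalfPlane)
    (hw' : w + τ ∈ lowerHalfPlane) (n : ℤ) :
    fourierCoeffAt F w n = e τ ^ (n - 1) *
      (fourierCoeffAt F (w + τ) (n - 2) - fourierCoeffAt F (w + τ) (n - 1)) := by
  have hc := fun m => (continuous_fourier_integrand hF.1 hw' m).intervalIntegrable
    (μ := MeasureTheory.volume) 0 1
  simp only [fourierCoeffAt]
  rw [← intervalIntegral.integral_sub (hc _) (hc _), ← intervalIntegral.integral_const_mul]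
  congr 1
  funext t
  have hq := e_ne_zero τ
  have hx := e_ne_zero (w + t)
  have ht : w + t + τ ∈ lowerHalfPlane := by
    rw [add_right_comm]; exact add_ofReal_mem hw' t
  rw [hF.2.2 (w + t) (add_ofReal_mem hw t) ht, add_right_comm w τ t, quadFactor, e_neg_int_mul,
    e_neg_int_mul, e_neg_int_mul, e_add (w + t) τ]
  generalize F (w + t + τ) = Y
  generalize e (w + t) = x at *
  generalize e τ = q at *
  rw [mul_zpow, mul_zpow, zpow_sub₀ hq, zpow_sub₀ hq, zpow_sub₀ hx, zpow_sub₀ hx]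
  have := zpow_ne_zero n hq
  have := zpow_ne_zero n hx
  simp only [zpow_ofNat]
  field_simp

/-- On the horizontal line through w, F is a continuous function on the circle. Its Fourier
coefficients are all zero, hence summable, so its Fourier series converges pointwise to it. -/
theorem eq_zero_of_fourierCoeffAt_eq_zero {F : ℂ → ℂ}
    (hF : DifferentiableOn ℂ F lowerHalfPlane) (hper : ∀ z ∈ lowerHalfPlane, F (z + 1) = F z)
    {w : ℂ} (hw : w ∈ lowerHalfPlane) (h : ∀ n : ℤ, fourierCoeffAt F w n = 0) : F w = 0 := by
  have hp : Function.Periodic (fun t : ℝ => F (w + t)) 1 := by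
    intro t
    have h := hper _ (add_ofReal_mem hw t)
    simp only [Complex.ofReal_add, Complex.ofReal_one]
    rw [← h, add_assoc]
  have : Fact ((0 : ℝ) < 1) := ⟨zero_lt_one⟩
  let f : C(AddCircle (1 : ℝ), ℂ) :=
    ⟨hp.lift, continuous_coinduced_dom.mpr (continuous_comp_segment hF hw)⟩
  have hf : ∀ t : ℝ, f t = F (w + t) := fun t => hp.lift_coe t
  have hcoef : ∀ n, fourierCoeff f n = 0 := by
    intro n
    rw [fourierCoeff_eq_intervalIntegral f n 0]
    have h1 : ∀ t : ℝ, fourier (-n) (t : AddCircle (1 : ℝ)) • f t =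
        e (n * w) * (F (w + t) * e (-(n * (w + t)))) := by
      intro t
      rw [hf, fourier_coe_apply, smul_eq_mul, mul_left_comm, ← e_add, e, mul_comm]
      congr 2
      push_cast
      ring
    have h2 := h n
    rw [fourierCoeffAt] at h2
    simp only [h1]
    rw [zero_add, intervalIntegral.integral_const_mul, h2]
    simp
  have hs := has_pointwise_sum_fourier_series_of_summable (f := f)
    (by simpa only [funext hcoef] using summable_zero) ((0 : ℝ) : AddCircle (1 : ℝ))
  simp only [hcoef, zero_smul] at hs
  have h3 := hs.unique hasSum_zero
  rw [hf] at h3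
  simpa using h3

theorem eqOn_zero_of_mem_TSpace {τ : ℂ} (hτ : 0 < τ.im) {F : ℂ → ℂ}
    (hF : F ∈ TSpace τ lowerHalfPlane (quadFactor τ))
    (h0 : ∀ w ∈ lowerHalfPlane, fourierCoeffAt F w 0 = 0)
    (h1 : ∀ w ∈ lowerHalfPlane, fourierCoeffAt F w 1 = 0) : EqOn F 0 lowerHalfPlane := by
  -- A base point low enough that its translate by τ, namely -i, is still in the lower half-plane.
  have hu : (-τ - Complex.I) ∈ lowerHalfPlane := by
    have : (-τ - Complex.I).im < 0 := by
      simp only [Complex.sub_im, Complex.neg_im, Complex.I_im]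
      linarith
    exact this
  have hv : (-τ - Complex.I) + τ ∈ lowerHalfPlane := by
    rw [sub_add_eq_add_sub, neg_add_cancel]
    simp [lowerHalfPlane]
  set u := -τ - Complex.I
  set c : ℤ → ℂ := fun n => fourierCoeffAt F u n with hc
  have hrec : ∀ n, c n = e τ ^ (n - 1) * (c (n - 2) - c (n - 1)) := by
    intro n
    simp only [hc]
    rw [fourierCoeffAt_recurrence hF hu hv, fourierCoeffAt_eq hF.1 hF.2.1 hv hu,
      fourierCoeffAt_eq hF.1 hF.2.1 hv hu]
  have hzero : ∀ n, c n = 0 ∧ c (n + 1) = 0 := by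
    intro n
    induction n using Int.induction_on with
    | zero => exact ⟨h0 u hu, h1 u hu⟩
    | succ n ih =>
      refine ⟨ih.2, ?_⟩
      rw [hrec, show (n : ℤ) + 1 + 1 - 2 = n by ring, show (n : ℤ) + 1 + 1 - 1 = n + 1 by ring,
        ih.1, ih.2, sub_zero, mul_zero]
    | pred n ih =>
      have h := hrec (-n + 1)
      rw [show -(n : ℤ) + 1 - 2 = -n - 1 by ring, show -(n : ℤ) + 1 - 1 = -n by ring,
        ih.1, ih.2, sub_zero] at h
      rw [sub_add_cancel]
      exact ⟨(mul_eq_zero.1 h.symm).resolve_left (zpow_ne_zero _ (e_ne_zero τ)), ih.1⟩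
  intro w hw
  exact eq_zero_of_fourierCoeffAt_eq_zero hF.1 hF.2.1 hw fun n => by
    rw [fourierCoeffAt_eq hF.1 hF.2.1 hw hu]
    exact (hzero n).1

theorem sub_mul_mem_TSpace {τ : ℂ} {D : Set ℂ} {f F G : ℂ → ℂ} (hF : F ∈ TSpace τ D f)
    (hG : G ∈ TSpace τ D f) (a b : ℂ) : (fun z => a * F z - b * G z) ∈ TSpace τ D f :=
  (TSpace τ D f).sub_mem ((TSpace τ D f).smul_mem a hF) ((TSpace τ D f).smul_mem b hG)

theorem eqOn_of_fourierCoeffAt_eq {τ : ℂ} (hτ : 0 < τ.im) {F G : ℂ → ℂ}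
    (hF : F ∈ TSpace τ lowerHalfPlane (quadFactor τ))
    (hG : G ∈ TSpace τ lowerHalfPlane (quadFactor τ))
    (h0 : ∀ w ∈ lowerHalfPlane, fourierCoeffAt F w 0 = fourierCoeffAt G w 0)
    (h1 : ∀ w ∈ lowerHalfPlane, fourierCoeffAt F w 1 = fourierCoeffAt G w 1) :
    EqOn F G lowerHalfPlane := by
  have h := eqOn_zero_of_mem_TSpace hτ (sub_mul_mem_TSpace hF hG 1 1)
    (fun w hw => by rw [fourierCoeffAt_sub_mul hF.1 hG.1 hw, h0 w hw, sub_self])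
    (fun w hw => by rw [fourierCoeffAt_sub_mul hF.1 hG.1 hw, h1 w hw, sub_self])
  intro z hz
  simpa [sub_eq_zero] using h hz

theorem IsCanonicalVector.eqOn {τ : ℂ} (hτ : 0 < τ.im) {k : ℕ} {F G : ℂ → ℂ}
    (hF : IsCanonicalVector τ (quadFactor τ) 2 k F)
    (hG : IsCanonicalVector τ (quadFactor τ) 2 k G) : EqOn F G lowerHalfPlane := by
  refine eqOn_of_fourierCoeffAt_eq hτ hF.1 hG.1 (fun w hw => ?_) fun w hw => ?_
  · exact_mod_cast (hF.2 0 two_pos w hw).trans (hG.2 0 two_pos w hw).symm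
  · exact_mod_cast (hF.2 1 one_lt_two w hw).trans (hG.2 1 one_lt_two w hw).symm

theorem exists_isCanonicalVector {τ : ℂ} (hτ : 0 < τ.im) (k : ℕ) :
    ∃ F, IsCanonicalVector τ (quadFactor τ) 2 k F := by
  obtain ⟨a, hrec, ha, h0, h1⟩ :=
    exists_isRecurrent hτ (if 0 = k then 1 else 0) (if 1 = k then 1 else 0)
  refine ⟨laurentSum a, ha.mem_TSpace hrec, fun j hj w hw => ?_⟩
  rw [ha.fourierCoeffAt hw]
  interval_cases j
  · exact_mod_cast h0
  · exact_mod_cast h1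

/-! ### The product and its double series -/

theorem qPochInf_step {q : ℂ} (hq : ‖q‖ < 1) (a : ℂ) :
    qPochInf a q = (1 - a) * qPochInf (q * a) q := by
  have h : ∀ n, (1 - a) * qPoch (q * a) q n = qPoch a q (n + 1) := by
    intro n
    rw [qPoch, qPoch, Finset.prod_range_succ', pow_zero, mul_one, mul_comm]
    congr 1
    refine Finset.prod_congr rfl fun k _ => ?_
    rw [pow_succ']
    ring
  exact tendsto_nhds_unique ((tendsto_add_atTop_iff_nat 1).2 (tendsto_qPoch hq a))
    (((tendsto_qPoch hq (q * a)).const_mul (1 - a)).congr h)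

theorem productSide_functional {τ : ℂ} (hτ : 0 < τ.im) (z : ℂ) :
    productSide τ z = quadFactor τ z * productSide τ (z + τ) := by
  have hq := norm_e_lt_one hτ
  have hq0 := e_ne_zero τ
  have hx := e_ne_zero z
  simp only [productSide, quadFactor, qTheta, e_add]
  -- After peeling one factor off each product, what remains is (1 - x)(1 - qx) = (q x^2 - x)(1 -
  -- 1/x).
  rw [mul_comm (e z) (e τ), qPochInf_step hq (e z), qPochInf_step hq (e τ * e z),
    div_mul_cancel_left₀ hq0, qPochInf_step hq (e z)⁻¹, div_eq_mul_inv]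
  field_simp
  ring

theorem doubleTerm_eq (τ z : ℂ) (m : ℤ) (n : ℕ) : doubleTerm τ z (m, n) =
    e τ ^ (tri m + tri (n + 1)) / qPoch (e τ) (e τ) n * (-e z) ^ (m + n : ℤ) := by
  rw [doubleTerm, tri, tri, add_sub_cancel_right]

theorem hasSum_doubleTerm {τ : ℂ} (hτ : 0 < τ.im) (z : ℂ) :
    HasSum (doubleTerm τ z) (productSide τ z) := by
  have hq := norm_e_lt_one hτ
  have hq0 := e_ne_zero τ
  have hx := e_ne_zero z
  have hx' : -e z ≠ 0 := neg_ne_zero.2 hx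
  have hqx := mul_ne_zero hq0 hx
  -- Euler's series is taken at qx; the extra q^n turns the exponent tri n into tri (n + 1).
  have hE := hasSum_euler hq hq0 hqx
  rw [← Nat.cast_injective (R := ℤ).hasSum_iff fun n hn => by
    rw [qRecip_of_neg _ (not_le.1 fun h => hn ⟨n.toNat, by omega⟩), mul_zero, zero_mul]] at hE
  have hs := summable_mul_of_summable_norm (summable_norm_zpow_tri hq hq0 hx')
    ((summable_norm_euler hq hq0 (neg_ne_zero.2 hqx)).comp_injective
      (Nat.cast_injective (R := ℤ)))
  have h := (hasSum_jacobi hq hq0 hx).mul hE hs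
  refine h.congr_fun fun p => ?_
  obtain ⟨m, n⟩ := p
  rw [doubleTerm_eq, Function.comp_apply, qRecip_natCast, tri_add_one, zpow_add₀ hq0,
    zpow_add₀ hq0, zpow_add₀ hx', ← mul_neg, mul_zpow]
  ring

/-- The coefficient of `(-x)^k` in the double series is the sum of these over `n`. -/
noncomputable def fiberTerm (τ : ℂ) (k : ℤ) (n : ℕ) : ℂ :=
  e τ ^ (tri (k - n) + tri (n + 1)) / qPoch (e τ) (e τ) n

theorem hasSum_fiberTerm_prod {τ : ℂ} (hτ : 0 < τ.im) (z : ℂ) :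
    HasSum (fun p : ℤ × ℕ => (-e z) ^ p.1 * fiberTerm τ p.1 p.2) (productSide τ z) := by
  let φ : ℤ × ℕ ≃ ℤ × ℕ :=
    { toFun := fun p => (p.1 - p.2, p.2)
      invFun := fun p => (p.1 + p.2, p.2)
      left_inv := fun p => by ext <;> simp
      right_inv := fun p => by ext <;> simp }
  refine (φ.hasSum_iff.2 (hasSum_doubleTerm hτ z)).congr_fun fun p => ?_
  change _ = doubleTerm τ z (p.1 - p.2, p.2)
  rw [doubleTerm_eq, sub_add_cancel, fiberTerm, mul_comm]

theorem summable_fiberTerm {τ : ℂ} (hτ : 0 < τ.im) (k : ℤ) : Summable (fiberTerm τ k) := by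
  have h := (hasSum_fiberTerm_prod hτ 0).summable.prod_factor k
  exact (summable_mul_left_iff (zpow_ne_zero k (neg_ne_zero.2 (e_ne_zero 0)))).1 h

/-- The coefficient of `x^k` in the double series. -/
noncomputable def productCoeff (τ : ℂ) (k : ℤ) : ℂ := (-1) ^ k * ∑' n, fiberTerm τ k n

theorem hasSum_productCoeff {τ : ℂ} (hτ : 0 < τ.im) (z : ℂ) :
    HasSum (fun k : ℤ => productCoeff τ k * e z ^ k) (productSide τ z) := by
  have hfib : ∀ k : ℤ, HasSum (fun n => (-e z) ^ k * fiberTerm τ k n)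
      ((-e z) ^ k * ∑' n, fiberTerm τ k n) :=
    fun k => (summable_fiberTerm hτ k).hasSum.mul_left ((-e z) ^ k)
  have h := (hasSum_fiberTerm_prod hτ z).prod_fiberwise hfib
  refine h.congr_fun fun k => ?_
  rw [productCoeff, neg_eq_neg_one_mul (e z), mul_zpow]
  ring

/-- Every R > 1 is |x| for some z, and the coefficient series converges unconditionally, hence
absolutely, for all z. -/
theorem isLaurentCoeff_productCoeff {τ : ℂ} (hτ : 0 < τ.im) :
    IsLaurentCoeff (productCoeff τ) := by
  intro R hR
  obtain ⟨z, hz⟩ : ∃ z, ‖e z‖ = R := by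
    refine ⟨(-(Real.log R / (2 * Real.pi)) : ℝ) * Complex.I, ?_⟩
    rw [norm_e, Complex.im_ofReal_mul, Complex.I_im, mul_one, mul_neg, neg_neg,
      mul_div_cancel₀ _ Real.two_pi_pos.ne', Real.exp_log (zero_lt_one.trans hR)]
  have h := (hasSum_productCoeff hτ z).summable.norm
  simpa only [norm_mul, norm_zpow, hz] using h

theorem laurentSum_productCoeff {τ : ℂ} (hτ : 0 < τ.im) :
    laurentSum (productCoeff τ) = productSide τ :=
  funext fun z => (hasSum_productCoeff hτ z).tsum_eq

theorem productSide_mem_TSpace {τ : ℂ} (hτ : 0 < τ.im) :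
    productSide τ ∈ TSpace τ lowerHalfPlane (quadFactor τ) := by
  refine ⟨?_, fun z _ => by simp only [productSide, e_add_one],
    fun z _ _ => productSide_functional hτ z⟩
  rw [← laurentSum_productCoeff hτ]
  exact (isLaurentCoeff_productCoeff hτ).differentiableOn

theorem fourierCoeffAt_productSide {τ : ℂ} (hτ : 0 < τ.im) {w : ℂ} (hw : w ∈ lowerHalfPlane)
    (n : ℤ) : fourierCoeffAt (productSide τ) w n = productCoeff τ n := by
  rw [← laurentSum_productCoeff hτ, (isLaurentCoeff_productCoeff hτ).fourierCoeffAt hw]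

theorem hasSum_productCoeff_zero {τ : ℂ} (hτ : 0 < τ.im) :
    HasSum (fun n : ℕ => e τ ^ (n ^ 2 + n) / qPoch (e τ) (e τ) n) (productCoeff τ 0) := by
  have h := (summable_fiberTerm hτ 0).hasSum
  rw [productCoeff, zpow_zero, one_mul]
  refine h.congr_fun fun n => ?_
  rw [fiberTerm, ← zpow_natCast]
  congr 2
  push_cast
  linarith [two_mul_tri (0 - n), two_mul_tri (n + 1)]

theorem hasSum_productCoeff_one {τ : ℂ} (hτ : 0 < τ.im) :
    HasSum (fun n : ℕ => e τ ^ (n ^ 2) / qPoch (e τ) (e τ) n) (-productCoeff τ 1) := by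
  have h := (summable_fiberTerm hτ 1).hasSum
  rw [productCoeff, zpow_one, neg_mul, one_mul, neg_neg]
  refine h.congr_fun fun n => ?_
  rw [fiberTerm, ← zpow_natCast]
  congr 2
  push_cast
  linarith [two_mul_tri (1 - n), two_mul_tri (n + 1)]

/-! ### Comparison with the canonical vectors -/

section CanonicalVectors

variable {τ : ℂ} {v₀ v₁ : ℂ → ℂ}

theorem IsCanonicalVector.fourierCoeffAt_combination
    (h₀ : IsCanonicalVector τ (quadFactor τ) 2 0 v₀)
    (h₁ : IsCanonicalVector τ (quadFactor τ) 2 1 v₁) (a b : ℂ) {w : ℂ} (hw : w ∈ lowerHalfPlane) :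
    fourierCoeffAt (fun z => a * v₀ z - b * v₁ z) w 0 = a ∧
      fourierCoeffAt (fun z => a * v₀ z - b * v₁ z) w 1 = -b := by
  have h00 := h₀.2 0 two_pos w hw
  have h01 := h₀.2 1 one_lt_two w hw
  have h10 := h₁.2 0 two_pos w hw
  have h11 := h₁.2 1 one_lt_two w hw
  norm_num at h00 h01 h10 h11
  rw [fourierCoeffAt_sub_mul h₀.1.1 h₁.1.1 hw, fourierCoeffAt_sub_mul h₀.1.1 h₁.1.1 hw, h00, h01,
    h10, h11]
  simp

theorem eqOn_productSide_iff (hτ : 0 < τ.im) (h₀ : IsCanonicalVector τ (quadFactor τ) 2 0 v₀)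
    (h₁ : IsCanonicalVector τ (quadFactor τ) 2 1 v₁) (a b : ℂ) :
    EqOn (productSide τ) (fun z => a * v₀ z - b * v₁ z) lowerHalfPlane ↔
      productCoeff τ 0 = a ∧ -productCoeff τ 1 = b := by
  have hc := fun {w : ℂ} (hw : w ∈ lowerHalfPlane) => h₀.fourierCoeffAt_combination h₁ a b hw
  constructor
  · intro h
    have hw : -Complex.I ∈ lowerHalfPlane := by simp [lowerHalfPlane]
    rw [← fourierCoeffAt_productSide hτ hw, ← fourierCoeffAt_productSide hτ hw,
      fourierCoeffAt_congr h hw, fourierCoeffAt_congr h hw, (hc hw).1, (hc hw).2, neg_neg]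
    exact ⟨rfl, rfl⟩
  · rintro ⟨ha, hb⟩
    refine eqOn_of_fourierCoeffAt_eq hτ (productSide_mem_TSpace hτ)
      (sub_mul_mem_TSpace h₀.1 h₁.1 a b) (fun w hw => ?_) fun w hw => ?_
    · rw [fourierCoeffAt_productSide hτ hw, (hc hw).1, ha]
    · rw [fourierCoeffAt_productSide hτ hw, (hc hw).2, ← hb, neg_neg]

theorem hasSum_doubleTerm_combination_iff (hτ : 0 < τ.im)
    (h₀ : IsCanonicalVector τ (quadFactor τ) 2 0 v₀)
    (h₁ : IsCanonicalVector τ (quadFactor τ) 2 1 v₁) (a b : ℂ) :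
    (∀ z ∈ lowerHalfPlane, HasSum (doubleTerm τ z) (a * v₀ z - b * v₁ z)) ↔
      HasSum (fun n : ℕ => e τ ^ (n ^ 2 + n) / qPoch (e τ) (e τ) n) a ∧
        HasSum (fun n : ℕ => e τ ^ (n ^ 2) / qPoch (e τ) (e τ) n) b := by
  have hA := hasSum_productCoeff_zero hτ
  have hB := hasSum_productCoeff_one hτ
  have h1 : (∀ z ∈ lowerHalfPlane, HasSum (doubleTerm τ z) (a * v₀ z - b * v₁ z)) ↔
      EqOn (productSide τ) (fun z => a * v₀ z - b * v₁ z) lowerHalfPlane :=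
    forall₂_congr fun z _ =>
      ⟨fun h => (hasSum_doubleTerm hτ z).unique h, fun h => by
        have h' := hasSum_doubleTerm hτ z
        rwa [h] at h'⟩
  rw [h1, eqOn_productSide_iff hτ h₀ h₁]
  exact and_congr ⟨fun h => h ▸ hA, hA.unique⟩ ⟨fun h => h ▸ hB, hB.unique⟩

theorem second_equality_iff (hτ : 0 < τ.im) (h₀ : IsCanonicalVector τ (quadFactor τ) 2 0 v₀)
    (h₁ : IsCanonicalVector τ (quadFactor τ) 2 1 v₁) :
    (∀ z ∈ lowerHalfPlane, HasSum (doubleTerm τ z)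
      (v₀ z / qTheta (e τ ^ 2) (e τ ^ 5) - v₁ z / qTheta (e τ) (e τ ^ 5))) ↔ RogersRamanujan τ := by
  have h := hasSum_doubleTerm_combination_iff hτ h₀ h₁ (1 / qTheta (e τ ^ 2) (e τ ^ 5))
    (1 / qTheta (e τ) (e τ ^ 5))
  simp only [one_div_mul_eq_div] at h
  rw [h, RogersRamanujan, and_comm]

end CanonicalVectors

theorem rogersRamanujan {τ : ℂ} (hτ : 0 < τ.im) : RogersRamanujan τ :=
  ⟨hasSum_rogersRamanujan_one (norm_e_lt_one hτ) (e_ne_zero τ),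
    hasSum_rogersRamanujan_two (norm_e_lt_one hτ) (e_ne_zero τ)⟩

end RogRam

theorem proposition1p2 (τ : ℂ) (hτ : 0 < τ.im) :
    -- the canonical vectors `[qx^2 - x; k]`, `k = 0, 1`, exist and are unique
    (∀ k < 2, ∃ F : ℂ → ℂ, RogRam.IsCanonicalVector τ (RogRam.quadFactor τ) 2 k F ∧
      ∀ G : ℂ → ℂ, RogRam.IsCanonicalVector τ (RogRam.quadFactor τ) 2 k G →
        Set.EqOn G F RogRam.lowerHalfPlane) ∧
    -- the product lies in the space `T(qx^2 - x)` over the lower half-plane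
    RogRam.productSide τ ∈ RogRam.TSpace τ RogRam.lowerHalfPlane (RogRam.quadFactor τ) ∧
    -- the first equality, with (absolute) convergence of the double sum
    (∀ z ∈ RogRam.lowerHalfPlane, HasSum (RogRam.doubleTerm τ z) (RogRam.productSide τ z)) ∧
    ∀ v₀ v₁ : ℂ → ℂ,
      RogRam.IsCanonicalVector τ (RogRam.quadFactor τ) 2 0 v₀ →
      RogRam.IsCanonicalVector τ (RogRam.quadFactor τ) 2 1 v₁ →
      -- the second equality
      (∀ z ∈ RogRam.lowerHalfPlane,
        HasSum (RogRam.doubleTerm τ z)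
          (v₀ z / RogRam.qTheta (RogRam.e τ ^ 2) (RogRam.e τ ^ 5) -
            v₁ z / RogRam.qTheta (RogRam.e τ) (RogRam.e τ ^ 5))) ∧
      -- the two equalities together are equivalent to the Rogers-Ramanujan identities
      ((∀ z ∈ RogRam.lowerHalfPlane,
        HasSum (RogRam.doubleTerm τ z) (RogRam.productSide τ z) ∧
        HasSum (RogRam.doubleTerm τ z)
          (v₀ z / RogRam.qTheta (RogRam.e τ ^ 2) (RogRam.e τ ^ 5) -
            v₁ z / RogRam.qTheta (RogRam.e τ) (RogRam.e τ ^ 5))) ↔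
        RogRam.RogersRamanujan τ) ∧
      -- the equivalence does not depend on the particular values of the coefficients
      (∀ a b : ℂ,
        (∀ z ∈ RogRam.lowerHalfPlane, HasSum (RogRam.doubleTerm τ z) (a * v₀ z - b * v₁ z)) ↔
          HasSum (fun n : ℕ => RogRam.e τ ^ (n ^ 2 + n) /
            RogRam.qPoch (RogRam.e τ) (RogRam.e τ) n) a ∧
          HasSum (fun n : ℕ => RogRam.e τ ^ (n ^ 2) /
            RogRam.qPoch (RogRam.e τ) (RogRam.e τ) n) b) := by
  refine ⟨fun k _ => ?_, RogRam.productSide_mem_TSpace hτ,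
    fun z _ => RogRam.hasSum_doubleTerm hτ z, fun v₀ v₁ h₀ h₁ => ?_⟩
  · obtain ⟨F, hF⟩ := RogRam.exists_isCanonicalVector hτ k
    exact ⟨F, hF, fun G hG => hG.eqOn hτ hF⟩
  · have h := RogRam.second_equality_iff hτ h₀ h₁
    -- The second equality is deduced from the independently proved Rogers-Ramanujan identities. The
    -- first holds unconditionally, so it adds nothing to the equivalence.
    refine ⟨h.2 (RogRam.rogersRamanujan hτ), ?_,
      RogRam.hasSum_doubleTerm_combination_iff hτ h₀ h₁⟩
    rw [← h]
    exact ⟨fun H z hz => (H z hz).2, fun H z hz => ⟨RogRam.hasSum_doubleTerm hτ z, H z hz⟩⟩
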